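/- **Notation.** For $\theta\in\mathbb R^{\mathbf d}$, $s\in\mathbb N_0$, $m,n\in\mathbb N$ with $\mathbf d\ge s+mn+m$ let $\mathscr A^{\theta,s}_{m,n}\colon\mathbb R^n\to\mathbb R^m$ be the affine function whose $i$-th component is $x\mapsto\sum_{j=1}^n\theta_{s+(i-1)n+j}x_j+\theta_{s+mn+i}$. For $\mathbf L\in\mathbb N$, $\mathbf l=(\mathbf l_0,\dots,\mathbf l_{\mathbf L})\in\mathbb N^{\mathbf L+1}$, $u<v$ and $\theta\in\mathbb R^{\mathbf d}$ with $\mathbf d\ge\sum_{k=1}^{\mathbf L}\mathbf l_k(\mathbf l_{k-1}+1)$ let $\mathscr N^{\theta,\mathbf l}_{u,v}\colon\mathbb R^{\mathbf l_0}\to\mathbb R^{\mathbf l_{\mathbf L}}$ be the rectified clipped network $$\mathscr N^{\theta,\mathbf l}_{u,v}=\mathbf a_{\mathbf L}\circ\mathscr A^{\theta,s_{\mathbf L}}_{\mathbf l_{\mathbf L},\mathbf l_{\mathbf L-1}}\circ\dots\circ\mathbf a_1\circ\mathscr A^{\theta,s_1}_{\mathbf l_1,\mathbf l_0},\qquad s_k=\sum_{i=1}^{k-1}\mathbf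 l_i(\mathbf l_{i-1}+1),$$ where $\mathbf a_k$ is the componentwise application of $x\mapsto\max\{x,0\}$ for $k<\mathbf L$ and of $x\mapsto\max\{\min\{x,v\},u\}$ for $k=\mathbf L$. Let $\|x\|_1=\sum_i|x_i|$ and $\|x\|_\infty=\max_i|x_i|$, and let $\mathbf 1_S$ be the indicator function of a set $S$. **Theorem.** Let $d,\mathbf d,\mathbf L,M,K,N\in\mathbb N=\{1,2,\dots\}$, $A,p\in(0,\infty)$, $L\in[0,\infty)$, $a,u\in\mathbb R$, $v\in(u,\infty)$, $b\in(a,\infty)$, $c\in[\max\{1,2|u|,2|v|,|a|,|b|,L\},\infty)$, $\beta\in[c,\infty)$, $\mathbf l=(\mathbf l_0,\dots,\mathbf l_{\mathbf L})\in\mathbb N^{\mathbf L+1}$, and let $\mathfrak N\subseteq\{0,1,\dots,N\}$ satisfy $0\in\mathfrak N$. Assume $$\mathbf L\ge1+\bigl(\lceil\log_2(A/(2d))\rceil+1\bigr)\mathbf 1_{(6^d,\infty)}(A),\quad \mathbf l_0=d,\quad \mathbf l_1\ge A\,\mathbf 1_{(6^d,\infty)}(A),\quad \mathbf l_{\mathbf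 L}=1,\quad \mathbf d\ge\sum_{i=1}^{\mathbf L}\mathbf l_i(\mathbf l_{i-1}+1),$$ and $\mathbf l_i\ge3\lceil A/(2^id)\rceil\,\mathbf 1_{(6^d,\infty)}(A)$ for all $i\in\{2,3,\dots,\mathbf L-1\}$. Let $(\Omega,\mathcal F,\mathbb P)$ be a probability space, let $(X_j,Y_j)\colon\Omega\to[a,b]^d\times[u,v]$, $j\in\{1,\dots,M\}$, be i.i.d. random variables, let $\mathcal E\colon[a,b]^d\to[u,v]$ satisfy $\mathbb P$-a.s. that $\mathcal E(X_1)=\mathbb E[Y_1|X_1]$, and assume $|\mathcal E(x)-\mathcal E(y)|\le L\|x-y\|_1$ for all $x,y\in[a,b]^d$. Let $\Theta_{k,n}\colon\Omega\to\mathbb R^{\mathbf d}$, $k,n\in\mathbb N_0$, and $\mathbf k\colon\Omega\to(\mathbb N_0)^2$ be random variables, assume that $\Theta_{k,0}$, $k\in\{1,\dots,K\}$, are i.i.d. and that $\Theta_{1,0}$ is continuous uniformly distributed on $[-c,c]^{\mathbf d}$, and assume for all $\omega\in\Omega$ that $$\mathbf k(\omega)\in\operatorname*{arg\,min}_{(k,n)\in\{1,\dots,K\}\times\mathfrak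 N,\ \|\Theta_{k,n}(\omega)\|_\infty\le\beta}\mathcal R(\Theta_{k,n}(\omega),\omega),\qquad \mathcal R(\theta,\omega)=\frac1M\sum_{j=1}^M\bigl|\mathscr N^{\theta,\mathbf l}_{u,v}(X_j(\omega))-Y_j(\omega)\bigr|^2.$$ Then the function $\Omega\ni\omega\mapsto\int_{[a,b]^d}|\mathscr N^{\Theta_{\mathbf k(\omega)}(\omega),\mathbf l}_{u,v}(x)-\mathcal E(x)|^2\,\mathbb P_{X_1}(\mathrm dx)\in[0,\infty]$ is measurable and $$\Bigl(\mathbb E\Bigl[\Bigl(\int_{[a,b]^d}\bigl|\mathscr N^{\Theta_{\mathbf k},\mathbf l}_{u,v}(x)-\mathcal E(x)\bigr|^2\,\mathbb P_{X_1}(\mathrm dx)\Bigr)^p\Bigr]\Bigr)^{1/p}\le\frac{9d^2L^2(b-a)^2}{A^{2/d}}+\frac{4(v-u)\mathbf L(\|\mathbf l\|_\infty+1)^{\mathbf L}c^{\mathbf L+1}\max\{p,1\}}{K^{[\mathbf L^{-1}(\|\mathbf l\|_\infty+1)^{-2}]}}$$ $$\qquad{}+\frac{10(\max\{v-u,1\})^2\,\mathbf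 L(\|\mathbf l\|_\infty+1)^{3/2}\max\{p,\ln(4M\beta c)\}}{\sqrt M}.$$ -/

import Mathlib

open MeasureTheory ProbabilityTheory

namespace ClippedDNN

noncomputable section

/-- The `i`-th entry (counted from `0`) of a parameter vector `θ ∈ ℝ^𝐝`. The fallback value `0`
is never used for networks with `𝐝 ≥ s + ∑ₖ lₖ (lₖ₋₁ + 1)`. -/
def param {dp : ℕ} (θ : Fin dp → ℝ) (i : ℕ) : ℝ :=
  if h : i < dp then θ ⟨i, h⟩ else 0

/-- The affine function `ℝⁿ → ℝᵐ` read off from the entries of `θ` after the first `s` ones: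
first the weight matrix, row by row, then the bias vector. -/
def affine {dp : ℕ} (θ : Fin dp → ℝ) (s m n : ℕ) (x : Fin n → ℝ) : Fin m → ℝ :=
  fun i => (∑ j : Fin n, param θ (s + (i * n + j)) * x j) + param θ (s + (m * n + i))

/-- The network `a_k ∘ 𝒜_k ∘ ⋯ ∘ a_1 ∘ 𝒜_1` of depth `k` with layer dimensions `l_0, …, l_k`
and activation functions `a_1, …, a_k`, whose parameters are the entries of `θ` after the first
`s` ones. -/
def network {dp : ℕ} (l : ℕ → ℕ) (a : (k : ℕ) → (Fin (l k) → ℝ) → (Fin (l k) → ℝ))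
    (θ : Fin dp → ℝ) (s : ℕ) : (k : ℕ) → (Fin (l 0) → ℝ) → (Fin (l k) → ℝ)
  | 0, x => x
  | k + 1, x =>
      a (k + 1) (affine θ (s + ∑ j ∈ Finset.range k, l (j + 1) * (l j + 1)) (l (k + 1)) (l k)
        (network l a θ s k x))

/-- The rectifier function. -/
def relu (x : ℝ) : ℝ := max x 0

/-- The clipping function. -/
def clip (u v x : ℝ) : ℝ := max (min x v) u

/-- The rectified clipped network of depth `L`: the rectifier is applied componentwise in the
layers `1, …, L - 1`, the clipping function componentwise in layer `L`. -/
def clippedNetwork {dp : ℕ} (l : ℕ → ℕ) (L : ℕ) (u v : ℝ) (θ : Fin dp → ℝ) :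
    (Fin (l 0) → ℝ) → (Fin (l L) → ℝ) :=
  network l (fun k y i => if k = L then clip u v (y i) else relu (y i)) θ 0 L

/-- The rectified clipped network as a function `ℝᵈ → ℝ`, if `l_0 = d` and `l_L = 1`. -/
def scalarNetwork {dp d : ℕ} (l : ℕ → ℕ) (L : ℕ) (hl0 : l 0 = d) (hlL : l L = 1) (u v : ℝ)
    (θ : Fin dp → ℝ) (x : Fin d → ℝ) : ℝ :=
  clippedNetwork l L u v θ (fun i => x (Fin.cast hl0 i)) (Fin.cast hlL.symm 0)

/-- The maximum norm of the vector `(l_0, …, l_L)` of layer dimensions. -/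
def maxWidth (l : ℕ → ℕ) (L : ℕ) : ℕ := (Finset.range (L + 1)).sup l

/-- The empirical risk of a predictor `f` on the samples `(x_1, y_1), …, (x_M, y_M)`. -/
def empiricalRisk {d : ℕ} (M : ℕ) (x : ℕ → Fin d → ℝ) (y : ℕ → ℝ) (f : (Fin d → ℝ) → ℝ) : ℝ :=
  (1 / (M : ℝ)) * ∑ j ∈ Finset.Icc 1 M, |f (x j) - y j| ^ 2

/-- The set of minimizers of `f` over `S`. -/
def argMin {α : Type*} (f : α → ℝ) (S : Set α) : Set α :=
  {x | x ∈ S ∧ ∀ y ∈ S, f x ≤ f y}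

/-- The cube `[a,b]^d`. -/
def cube (d : ℕ) (a b : ℝ) : Set (Fin d → ℝ) := Set.Icc (fun _ => a) (fun _ => b)

end

end ClippedDNN

/-!
The squared `L²` error of the selected network splits into an approximation, an optimization and a
generalization error. As `E` is the regression function, the error `e(θ)` of the network with
parameter `θ` is its risk minus the risk of `E` (`integral_sq_loss_eq_add`). Almost surely every
initialization `Θ k 0` lies in `[-c, c]^𝐝`, hence is admissible for the selection, so that replacing
risks by empirical risks gives `e(Θ κ) ≤ e(Θ k 0) + 2 S` for all `k`, where `S` bounds the deviation
of the empirical risk from the risk on all of `[-β, β]^𝐝` (`error_le_of_argMin`). Moreover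
`e(Θ k 0) ≤ e(θ*) + C ‖Θ k 0 - θ*‖` for any fixed `θ*` in `[-c, c]^𝐝`, since clipped networks are
Lipschitz continuous in their parameters (`abs_scalarNetwork_sub_le`). After minimizing over `k`,
Minkowski's inequality for the exponent `max p 1` leaves three terms.

* Approximation (`exists_scalarNetwork_approx`): for `A > 6 ^ d` the parameter `θ*` realizes the
  lower McShane extension `max_z (E z - Lip ‖x - z‖₁)` of `E` from a grid with at most `A / (2 d)` points.
  The first layer computes the positive and negative parts of `x i - z i`, and each further layer
  halves the number of terms in the maximum (`MaxRealizable.succ`). For `A ≤ 6 ^ d` a constant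
  network suffices.
* Optimization (`lintegral_inf_paramDist_rpow_le`): only the `D ≤ L (W + 1) ^ 2` parameters that the
  network uses matter, where `W` is the maximal width, and `K` independent uniform points of a
  `D`-dimensional cube come within distance of order `K ^ (-1 / D)` of `θ*`.
* Generalization (`exists_generalization_bound`): on a finite grid of parameters the maximal
  deviation of the empirical risk is controlled by Hoeffding's lemma and a moment bound for maxima of
  sub-Gaussian random variables (`lintegral_sup_abs_rpow_le`); Lipschitz continuity covers the other
  parameters. The grid is so large that its discretization error is of order `1 / √M`, but its
  size enters only logarithmically.
-/

namespace ClippedDNN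

/-! ### Networks with componentwise activations -/

/-- The number of parameters used by the layers `1, …, k`. -/
def paramCount (l : ℕ → ℕ) (k : ℕ) : ℕ := ∑ j ∈ Finset.range k, l (j + 1) * (l j + 1)

/-- The network of depth `k` in which the activation function of layer `j` is the componentwise
application of `φ j`. -/
def componentwiseNetwork {dp : ℕ} (l : ℕ → ℕ) (φ : ℕ → ℝ → ℝ) (θ : Fin dp → ℝ) (k : ℕ)
    (x : Fin (l 0) → ℝ) : Fin (l k) → ℝ :=
  network l (fun k y i => φ k (y i)) θ 0 k x

/-- The activation function of layer `k` of a clipped network of depth `L`. -/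
noncomputable def activation (L : ℕ) (u v : ℝ) (k : ℕ) (t : ℝ) : ℝ :=
  if k = L then clip u v t else relu t

lemma paramCount_succ (l : ℕ → ℕ) (k : ℕ) :
    paramCount l (k + 1) = paramCount l k + l (k + 1) * (l k + 1) :=
  Finset.sum_range_succ _ _

lemma paramCount_mono (l : ℕ → ℕ) : Monotone (paramCount l) :=
  monotone_nat_of_le_succ fun k => by rw [paramCount_succ]; omega

lemma paramCount_eq (l : ℕ → ℕ) (L : ℕ) :
    paramCount l L = ∑ i ∈ Finset.Icc 1 L, l i * (l (i - 1) + 1) := by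
  induction L with
  | zero => simp [paramCount]
  | succ k ih => rw [paramCount_succ, ih, Finset.sum_Icc_succ_top (by omega)]; simp

lemma componentwiseNetwork_zero {dp : ℕ} (l : ℕ → ℕ) (φ : ℕ → ℝ → ℝ) (θ : Fin dp → ℝ)
    (x : Fin (l 0) → ℝ) : componentwiseNetwork l φ θ 0 x = x := rfl

lemma componentwiseNetwork_succ {dp : ℕ} (l : ℕ → ℕ) (φ : ℕ → ℝ → ℝ) (θ : Fin dp → ℝ) (k : ℕ)
    (x : Fin (l 0) → ℝ) (i : Fin (l (k + 1))) :
    componentwiseNetwork l φ θ (k + 1) x i = φ (k + 1) (affine θ (paramCount l k) (l (k + 1)) (l k)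
      (componentwiseNetwork l φ θ k x) i) := by
  simp only [componentwiseNetwork, network, paramCount, zero_add]

lemma scalarNetwork_eq {dp d : ℕ} (l : ℕ → ℕ) (L : ℕ) (hl0 : l 0 = d) (hlL : l L = 1) (u v : ℝ)
    (θ : Fin dp → ℝ) (x : Fin d → ℝ) :
    scalarNetwork l L hl0 hlL u v θ x = componentwiseNetwork l (activation L u v) θ L
      (fun i => x (Fin.cast hl0 i)) (Fin.cast hlL.symm 0) := rfl

lemma weight_index_lt {m n : ℕ} (s : ℕ) (i : Fin m) (j : Fin n) :
    s + (i * n + j) < s + m * (n + 1) := by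
  have h1 := Nat.mul_le_mul_right n (Nat.succ_le_of_lt i.2)
  have h2 := j.2
  have h3 := i.2
  simp only [Nat.succ_eq_add_one, add_mul, mul_add] at *
  omega

lemma bias_index_lt {m : ℕ} (s n : ℕ) (i : Fin m) : s + (m * n + i) < s + m * (n + 1) := by
  have := i.2
  rw [mul_add]; omega

lemma affine_congr {dp : ℕ} {θ θ' : Fin dp → ℝ} {s m n : ℕ}
    (h : ∀ t < s + m * (n + 1), param θ t = param θ' t) : affine θ s m n = affine θ' s m n := by
  funext x i
  simp only [affine]
  rw [h _ (bias_index_lt s n i)]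
  congr 1
  exact Finset.sum_congr rfl fun j _ => by rw [h _ (weight_index_lt s i j)]

lemma componentwiseNetwork_congr {dp : ℕ} {l : ℕ → ℕ} {φ : ℕ → ℝ → ℝ} {θ θ' : Fin dp → ℝ} {k : ℕ}
    (h : ∀ t < paramCount l k, param θ t = param θ' t) :
    componentwiseNetwork l φ θ k = componentwiseNetwork l φ θ' k := by
  induction k with
  | zero => rfl
  | succ k ih =>
    rw [paramCount_succ] at h
    funext x i
    rw [componentwiseNetwork_succ, componentwiseNetwork_succ, affine_congr h,
      ih fun t ht => h t (by omega)]

lemma abs_param_le {dp : ℕ} {θ : Fin dp → ℝ} {B : ℝ} (hB : 0 ≤ B) (h : ∀ i, |θ i| ≤ B) (t : ℕ) :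
    |param θ t| ≤ B := by
  unfold param; split_ifs
  · exact h _
  · simpa using hB

lemma abs_affine_le {dp : ℕ} {θ : Fin dp → ℝ} {B R : ℝ} (s m : ℕ) {n : ℕ} {x : Fin n → ℝ}
    (hθ : ∀ t, |param θ t| ≤ B) (hx : ∀ j, |x j| ≤ R) (i : Fin m) :
    |affine θ s m n x i| ≤ n * (B * R) + B := by
  unfold affine
  refine (abs_add_le _ _).trans (add_le_add ((Finset.abs_sum_le_sum_abs _ _).trans ?_) (hθ _))
  refine (Finset.sum_le_card_nsmul _ _ (B * R) fun j _ => ?_).trans (by simp)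
  rw [abs_mul]
  exact mul_le_mul (hθ _) (hx j) (abs_nonneg _) ((abs_nonneg _).trans (hθ 0))

lemma abs_affine_sub_le {dp : ℕ} {θ θ' : Fin dp → ℝ} {B R δ ε : ℝ} {s m n : ℕ} {x x' : Fin n → ℝ}
    (hθ : ∀ t, |param θ t| ≤ B) (hx' : ∀ j, |x' j| ≤ R)
    (hδ : ∀ t < s + m * (n + 1), |param θ t - param θ' t| ≤ δ) (hε : ∀ j, |x j - x' j| ≤ ε)
    (i : Fin m) :
    |affine θ s m n x i - affine θ' s m n x' i| ≤ n * (B * ε + δ * R) + δ := by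
  have key : affine θ s m n x i - affine θ' s m n x' i
      = (∑ j : Fin n, (param θ (s + (i * n + j)) * (x j - x' j)
          + (param θ (s + (i * n + j)) - param θ' (s + (i * n + j))) * x' j))
        + (param θ (s + (m * n + i)) - param θ' (s + (m * n + i))) := by
    simp only [affine]
    rw [add_sub_add_comm, ← Finset.sum_sub_distrib]
    congr 1
    exact Finset.sum_congr rfl fun j _ => by ring
  rw [key]
  refine (abs_add_le _ _).trans (add_le_add ((Finset.abs_sum_le_sum_abs _ _).trans ?_)
    (hδ _ (bias_index_lt s n i)))
  refine (Finset.sum_le_card_nsmul _ _ (B * ε + δ * R) fun j _ => ?_).trans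
    (by simp [mul_add])
  refine (abs_add_le _ _).trans ?_
  rw [abs_mul, abs_mul]
  have h1 := hδ _ (weight_index_lt s i j)
  exact add_le_add (mul_le_mul (hθ _) (hε j) (abs_nonneg _) ((abs_nonneg _).trans (hθ 0)))
    (mul_le_mul h1 (hx' j) (abs_nonneg _) ((abs_nonneg _).trans h1))

lemma abs_relu_le (t : ℝ) : |relu t| ≤ |t| := by
  unfold relu
  rcases le_total t 0 with h | h
  · simp [h]
  · simp [h]

lemma abs_relu_sub_le (s t : ℝ) : |relu s - relu t| ≤ |s - t| :=
  abs_max_sub_max_le_abs s t 0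

lemma abs_clip_sub_le (u v s t : ℝ) : |clip u v s - clip u v t| ≤ |s - t| :=
  (abs_max_sub_max_le_abs _ _ _).trans (abs_inf_sub_inf_le_abs s t v)

lemma clip_mem_Icc {u v : ℝ} (huv : u ≤ v) (t : ℝ) : clip u v t ∈ Set.Icc u v :=
  ⟨le_max_right _ _, max_le (min_le_right _ _) huv⟩

lemma clip_eq_self {u v t : ℝ} (ht : t ∈ Set.Icc u v) : clip u v t = t := by
  unfold clip; rw [min_eq_left ht.2, max_eq_left ht.1]

lemma abs_activation_sub_le (L : ℕ) (u v : ℝ) (k : ℕ) (s t : ℝ) :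
    |activation L u v k s - activation L u v k t| ≤ |s - t| := by
  unfold activation; split_ifs
  · exact abs_clip_sub_le u v s t
  · exact abs_relu_sub_le s t

lemma measurable_activation (L : ℕ) (u v : ℝ) (k : ℕ) : Measurable (activation L u v k) := by
  unfold activation clip relu
  split_ifs
  · exact (measurable_id.min measurable_const).max measurable_const
  · exact measurable_id.max measurable_const

lemma scalarNetwork_mem_Icc {dp d : ℕ} {l : ℕ → ℕ} {L : ℕ} (hL : 1 ≤ L) (hl0 : l 0 = d)
    (hlL : l L = 1) {u v : ℝ} (huv : u ≤ v) (θ : Fin dp → ℝ) (x : Fin d → ℝ) :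
    scalarNetwork l L hl0 hlL u v θ x ∈ Set.Icc u v := by
  obtain ⟨k, rfl⟩ : ∃ k, L = k + 1 := ⟨L - 1, by omega⟩
  rw [scalarNetwork_eq, componentwiseNetwork_succ, activation, if_pos rfl]
  exact clip_mem_Icc huv _

/-! ### Growth, Lipschitz continuity in the parameters, and measurability -/

lemma one_le_growth {B : ℝ} (hB : 1 ≤ B) (W k : ℕ) : 1 ≤ (B * (W + 1)) ^ k * B := by
  have h : 1 ≤ B * ((W : ℝ) + 1) := one_le_mul_of_one_le_of_one_le hB (by simp)
  exact one_le_mul_of_one_le_of_one_le (one_le_pow₀ h) hB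

lemma abs_componentwiseNetwork_le {dp : ℕ} {l : ℕ → ℕ} {L W : ℕ} {u v B : ℝ} {θ : Fin dp → ℝ}
    (hW : ∀ k ≤ L, l k ≤ W) (hB : 1 ≤ B) (hθ : ∀ t, |param θ t| ≤ B) {x : Fin (l 0) → ℝ}
    (hx : ∀ j, |x j| ≤ B) {k : ℕ} (hk : k < L) (i : Fin (l k)) :
    |componentwiseNetwork l (activation L u v) θ k x i| ≤ (B * (W + 1)) ^ k * B := by
  induction k with
  | zero => simpa [componentwiseNetwork_zero] using hx i
  | succ k ih =>
    rw [componentwiseNetwork_succ, activation, if_neg hk.ne]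
    refine (abs_relu_le _).trans ((abs_affine_le _ _ hθ (ih (by omega)) i).trans ?_)
    have h1 := one_le_growth hB W k
    have h2 : (l k : ℝ) ≤ W := by exact_mod_cast hW k (by omega)
    set R := (B * ((W : ℝ) + 1)) ^ k * B
    calc (l k : ℝ) * (B * R) + B ≤ W * (B * R) + B * R := by
          gcongr
          nlinarith
      _ = (B * (W + 1)) ^ (k + 1) * B := by rw [pow_succ]; ring

lemma abs_componentwiseNetwork_sub_le {dp : ℕ} {l : ℕ → ℕ} {L W : ℕ} {u v B δ : ℝ}
    {θ θ' : Fin dp → ℝ} (hW : ∀ k ≤ L, l k ≤ W) (hB : 1 ≤ B) (hθ : ∀ t, |param θ t| ≤ B)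
    (hθ' : ∀ t, |param θ' t| ≤ B) (hδ0 : 0 ≤ δ)
    (hδ : ∀ t < paramCount l L, |param θ t - param θ' t| ≤ δ) {x : Fin (l 0) → ℝ}
    (hx : ∀ j, |x j| ≤ B) {k : ℕ} (hk : k ≤ L) (i : Fin (l k)) :
    |componentwiseNetwork l (activation L u v) θ k x i
      - componentwiseNetwork l (activation L u v) θ' k x i|
      ≤ k * ((B * (W + 1)) ^ k * δ) := by
  induction k with
  | zero => simp [componentwiseNetwork_zero]
  | succ k ih =>
    rw [componentwiseNetwork_succ, componentwiseNetwork_succ]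
    have hδ' : ∀ t < paramCount l k + l (k + 1) * (l k + 1), |param θ t - param θ' t| ≤ δ := by
      intro t ht
      rw [← paramCount_succ] at ht
      exact hδ t (ht.trans_le (paramCount_mono l hk))
    refine (abs_activation_sub_le L u v _ _ _).trans
      ((abs_affine_sub_le hθ (abs_componentwiseNetwork_le hW hB hθ' hx (by omega)) hδ'
        (ih (by omega)) i).trans ?_)
    have h1 := one_le_growth hB W k
    have h2 : (l k : ℝ) ≤ W := by exact_mod_cast hW k (by omega)
    have h3 : 0 ≤ (B * ((W : ℝ) + 1)) ^ k := by positivity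
    set R := (B * ((W : ℝ) + 1)) ^ k with hR
    calc (l k : ℝ) * (B * (k * (R * δ)) + δ * (R * B)) + δ
        ≤ W * (B * (k * (R * δ)) + δ * (R * B)) + (B * (k * (R * δ)) + δ * (R * B)) := by
          refine add_le_add (mul_le_mul_of_nonneg_right h2 (by positivity)) ?_
          have : 0 ≤ B * (k * (R * δ)) := by positivity
          nlinarith
      _ = ((k + 1 : ℕ) : ℝ) * ((B * (W + 1)) ^ (k + 1) * δ) := by
          rw [pow_succ, ← hR]; push_cast; ring

/-- On inputs and parameters bounded by `B ≥ 1`, a clipped network is Lipschitz continuous in the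
parameters that it uses, with constant `L (W + 1) ^ L B ^ L` if all layers have width at most
`W`. -/
lemma abs_scalarNetwork_sub_le {dp d : ℕ} {l : ℕ → ℕ} {L W : ℕ} (hl0 : l 0 = d) (hlL : l L = 1)
    {u v B δ : ℝ} {θ θ' : Fin dp → ℝ} (hW : ∀ k ≤ L, l k ≤ W) (hB : 1 ≤ B)
    (hθ : ∀ t, |param θ t| ≤ B) (hθ' : ∀ t, |param θ' t| ≤ B) (hδ0 : 0 ≤ δ)
    (hδ : ∀ t < paramCount l L, |param θ t - param θ' t| ≤ δ) {x : Fin d → ℝ}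
    (hx : ∀ j, |x j| ≤ B) :
    |scalarNetwork l L hl0 hlL u v θ x - scalarNetwork l L hl0 hlL u v θ' x|
      ≤ L * ((W : ℝ) + 1) ^ L * B ^ L * δ := by
  rw [scalarNetwork_eq, scalarNetwork_eq]
  refine (abs_componentwiseNetwork_sub_le hW hB hθ hθ' hδ0 hδ (fun j => hx _) le_rfl _).trans_eq ?_
  rw [mul_pow]; ring

lemma measurable_param {dp : ℕ} (t : ℕ) : Measurable fun θ : Fin dp → ℝ => param θ t := by
  unfold param; split_ifs
  · exact measurable_pi_apply _
  · exact measurable_const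

lemma measurable_componentwiseNetwork {dp : ℕ} (l : ℕ → ℕ) {φ : ℕ → ℝ → ℝ}
    (hφ : ∀ k, Measurable (φ k)) (k : ℕ) (i : Fin (l k)) :
    Measurable fun q : (Fin dp → ℝ) × (Fin (l 0) → ℝ) => componentwiseNetwork l φ q.1 k q.2 i := by
  induction k with
  | zero => exact (measurable_pi_apply i).comp measurable_snd
  | succ k ih =>
    simp only [componentwiseNetwork_succ, affine]
    refine (hφ _).comp (Measurable.add (Finset.measurable_sum _ fun j _ => ?_)
      ((measurable_param _).comp measurable_fst))
    exact ((measurable_param _).comp measurable_fst).mul (ih j)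

lemma measurable_scalarNetwork {dp d : ℕ} (l : ℕ → ℕ) (L : ℕ) (hl0 : l 0 = d) (hlL : l L = 1)
    (u v : ℝ) :
    Measurable fun q : (Fin dp → ℝ) × (Fin d → ℝ) => scalarNetwork l L hl0 hlL u v q.1 q.2 := by
  subst hl0
  exact measurable_componentwiseNetwork l (measurable_activation L u v) L _

/-! ### Networks assembled layer by layer -/

/-- Some choice of parameters in `[-c, c]` makes units of layer `k`, indexed injectively by `ι`,
compute the functions `F i`, `i ∈ ι`. -/
def Realizable (dp : ℕ) (l : ℕ → ℕ) (φ : ℕ → ℝ → ℝ) (c : ℝ) (k : ℕ) {ι : Type*}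
    (F : ι → (Fin (l 0) → ℝ) → ℝ) : Prop :=
  ∃ θ : Fin dp → ℝ, (∀ i, |θ i| ≤ c) ∧ ∃ e : ι ↪ Fin (l k),
    ∀ x i, componentwiseNetwork l φ θ k x (e i) = F i x

/-- The entries of a parameter vector that belong to one layer can be replaced so that this layer
has prescribed weights and biases, without changing the entries before. -/
lemma exists_affine_eq {dp s m n : ℕ} {c : ℝ} (hc : 0 ≤ c) {θ : Fin dp → ℝ} (hθ : ∀ i, |θ i| ≤ c)
    (h : s + m * (n + 1) ≤ dp) {w : Fin m → Fin n → ℝ} (hw : ∀ i j, |w i j| ≤ c) {b : Fin m → ℝ}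
    (hb : ∀ i, |b i| ≤ c) :
    ∃ θ' : Fin dp → ℝ, (∀ i, |θ' i| ≤ c) ∧ (∀ t < s, param θ' t = param θ t) ∧
      ∀ x i, affine θ' s m n x i = (∑ j, w i j * x j) + b i := by
  let w' : ℕ → ℕ → ℝ := fun i j => if h : i < m ∧ j < n then w ⟨i, h.1⟩ ⟨j, h.2⟩ else 0
  let b' : ℕ → ℝ := fun i => if h : i < m then b ⟨i, h⟩ else 0
  have hw' : ∀ i j, |w' i j| ≤ c := by
    intro i j; simp only [w']; split_ifs
    · exact hw _ _
    · simpa using hc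
  have hb' : ∀ i, |b' i| ≤ c := by
    intro i; simp only [b']; split_ifs
    · exact hb _
    · simpa using hc
  let θ' : Fin dp → ℝ := fun t => if (t : ℕ) < s then θ t else
    if (t : ℕ) - s < m * n then w' (((t : ℕ) - s) / n) (((t : ℕ) - s) % n)
    else b' ((t : ℕ) - s - m * n)
  refine ⟨θ', ?_, ?_, ?_⟩
  · intro i; simp only [θ']; split_ifs
    · exact hθ _
    · exact hw' _ _
    · exact hb' _
  · intro t ht
    simp only [param, θ', ht, if_true]
  · intro x i
    unfold affine
    congr 1
    · refine Finset.sum_congr rfl fun j _ => ?_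
      congr 1
      have h1 := weight_index_lt s i j
      have h2 : (i : ℕ) * n + j < m * n := by
        have h3 := Nat.mul_le_mul_right n (Nat.succ_le_of_lt i.2)
        have h4 := j.2
        simp only [Nat.succ_eq_add_one, add_mul] at h3
        omega
      have hn : 0 < n := j.pos
      have h5 : ((i : ℕ) * n + j) / n = i := by
        rw [mul_comm, Nat.mul_add_div hn, Nat.div_eq_of_lt j.2, add_zero]
      have h6 : ((i : ℕ) * n + j) % n = j := by
        rw [mul_comm, Nat.mul_add_mod, Nat.mod_eq_of_lt j.2]
      simp [param, θ', h1.trans_le h, h2, h5, h6, w']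
    · have h1 := bias_index_lt s n i
      simp [param, θ', h1.trans_le h, b']

lemma abs_extend_le {α β : Type*} (f : α ↪ β) {c : ℝ} (hc : 0 ≤ c) {g : α → ℝ}
    (hg : ∀ i, |g i| ≤ c) (j : β) : |Function.extend f g 0 j| ≤ c := by
  by_cases hj : ∃ i, f i = j
  · obtain ⟨i, rfl⟩ := hj
    rw [f.injective.extend_apply]; exact hg i
  · rw [Function.extend_apply' _ _ _ hj]; simpa using hc

/-- The units of layer `k` are the inputs of the next layer, in which any number of units that fits
its width can be given prescribed weights and biases in `[-c, c]`. -/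
lemma Realizable.succ {dp : ℕ} {l : ℕ → ℕ} {φ : ℕ → ℝ → ℝ} {c : ℝ} {k : ℕ} {ι ι' : Type*}
    [Fintype ι] [Fintype ι'] {F : ι → (Fin (l 0) → ℝ) → ℝ} (hF : Realizable dp l φ c k F)
    (hc : 0 ≤ c) (hdp : paramCount l (k + 1) ≤ dp) (hcard : Fintype.card ι' ≤ l (k + 1))
    {w : ι' → ι → ℝ} (hw : ∀ i j, |w i j| ≤ c) {b : ι' → ℝ} (hb : ∀ i, |b i| ≤ c) :
    Realizable dp l φ c (k + 1) fun i x => φ (k + 1) ((∑ j, w i j * F j x) + b i) := by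
  obtain ⟨θ, hθ, e, he⟩ := hF
  obtain ⟨e'⟩ : Nonempty (ι' ↪ Fin (l (k + 1))) :=
    Function.Embedding.nonempty_of_card_le (by simpa using hcard)
  let w₁ : ι' → Fin (l k) → ℝ := fun i => Function.extend e (w i) 0
  let w₂ : Fin (l (k + 1)) → Fin (l k) → ℝ := fun i j => Function.extend e' (fun i' => w₁ i' j) 0 i
  rw [paramCount_succ] at hdp
  obtain ⟨θ', hθ', hag, haff⟩ := exists_affine_eq hc hθ hdp (w := w₂)
    (fun i j => abs_extend_le e' hc
      (fun i' => abs_extend_le e hc (hw i') j) i)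
    (b := Function.extend e' b 0) (abs_extend_le e' hc hb)
  refine ⟨θ', hθ', e', fun x i => ?_⟩
  rw [componentwiseNetwork_succ, haff, componentwiseNetwork_congr hag]
  congr 2
  · symm
    refine Fintype.sum_of_injective e e.injective _ _ (fun j hj => ?_) (fun j => ?_)
    · simp only [w₂, w₁, e'.injective.extend_apply]
      rw [Function.extend_apply' _ _ _ (by simpa using hj)]; simp
    · simp only [w₂, w₁, e'.injective.extend_apply, e.injective.extend_apply, he]
  · rw [e'.injective.extend_apply]

lemma realizable_zero (dp : ℕ) (l : ℕ → ℕ) (φ : ℕ → ℝ → ℝ) {c : ℝ} (hc : 0 ≤ c) :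
    Realizable dp l φ c 0 fun (i : Fin (l 0)) x => x i :=
  ⟨0, fun _ => by simpa using hc, Function.Embedding.refl _, fun _ _ => rfl⟩

/-- `T` is the maximum of `m` functions, each of which is an affine combination of units of layer
`k`. The bounds on the differences are those that the weights of the next layer need, which computes
differences of these functions. -/
def MaxRealizable (dp : ℕ) (l : ℕ → ℕ) (φ : ℕ → ℝ → ℝ) (c : ℝ) (k m : ℕ)
    (T : (Fin (l 0) → ℝ) → ℝ) : Prop :=
  ∃ (κ : Type) (_ : Fintype κ) (F : κ → (Fin (l 0) → ℝ) → ℝ) (C : Fin m → κ → ℝ) (B : Fin m → ℝ),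
    Realizable dp l φ c k F ∧ (∀ j u, |C j u| ≤ c) ∧ (∀ j j' u, |C j u - C j' u| ≤ c) ∧
    (∀ j, |B j| ≤ c) ∧ (∀ j j', |B j - B j'| ≤ c) ∧
    ∀ x, IsGreatest (Set.range fun j => (∑ u, C j u * F u x) + B j) (T x)

lemma relu_sub_add_relu_sub_relu_neg (s t : ℝ) : relu (s - t) + relu t - relu (-t) = max s t := by
  unfold relu
  rcases le_total s t with h | h <;> rcases le_total t 0 with h' | h'
  · rw [max_eq_right (by linarith), max_eq_right h', max_eq_left (by linarith), max_eq_right h]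
    ring
  · rw [max_eq_right (by linarith), max_eq_left h', max_eq_right (by linarith), max_eq_right h]
    ring
  · rw [max_eq_left (by linarith), max_eq_right h', max_eq_left (by linarith), max_eq_left h]
    ring
  · rw [max_eq_left (by linarith), max_eq_left h', max_eq_right (by linarith), max_eq_left h]
    ring

lemma relu_add_relu_neg (t : ℝ) : relu t + relu (-t) = |t| := by
  unfold relu
  rcases le_total t 0 with h | h
  · rw [max_eq_right h, max_eq_left (by linarith), abs_of_nonpos h]; ring
  · rw [max_eq_left h, max_eq_right (by linarith), abs_of_nonneg h]; ring

/-- One rectified layer with three units per pair halves the number of functions in the maximum, as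
`max s t = relu (s - t) + relu t - relu (-t)`. -/
lemma MaxRealizable.succ {dp : ℕ} {l : ℕ → ℕ} {φ : ℕ → ℝ → ℝ} {c : ℝ} {k m : ℕ}
    {T : (Fin (l 0) → ℝ) → ℝ} (hT : MaxRealizable dp l φ c k m T) (hc : 1 ≤ c)
    (hdp : paramCount l (k + 1) ≤ dp) (hφ : φ (k + 1) = relu) (hl : 3 * ((m + 1) / 2) ≤ l (k + 1)) :
    MaxRealizable dp l φ c (k + 1) ((m + 1) / 2) T := by
  obtain ⟨κ, _, F, C, B, hF, hC, hCC, hB, hBB, hmax⟩ := hT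
  have hm : 0 < m := by
    obtain ⟨j, -⟩ := (hmax 0).1
    exact j.pos
  -- the last function is paired with itself if `m` is odd
  let α : Fin ((m + 1) / 2) → Fin m := fun j => ⟨2 * j, by have := j.2; omega⟩
  let β : Fin ((m + 1) / 2) → Fin m := fun j => ⟨min (2 * j + 1) (m - 1), by omega⟩
  have hsurj : ∀ i : Fin m, ∃ j, α j = i ∨ β j = i := by
    intro i
    have hi := i.2
    refine ⟨⟨i / 2, by omega⟩, ?_⟩
    rcases Nat.even_or_odd' i with ⟨r, h | h⟩
    · left; ext; simp only [α]; omega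
    · right; ext; simp only [β]; omega
  let w : Fin ((m + 1) / 2) × Fin 3 → κ → ℝ := fun q u =>
    (![C (α q.1) u - C (β q.1) u, C (β q.1) u, -C (β q.1) u] : Fin 3 → ℝ) q.2
  let b : Fin ((m + 1) / 2) × Fin 3 → ℝ := fun q =>
    (![B (α q.1) - B (β q.1), B (β q.1), -B (β q.1)] : Fin 3 → ℝ) q.2
  let F' : Fin ((m + 1) / 2) × Fin 3 → (Fin (l 0) → ℝ) → ℝ := fun q x =>
    φ (k + 1) ((∑ u, w q u * F u x) + b q)
  have hF' : Realizable dp l φ c (k + 1) F' := by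
    refine hF.succ (by linarith) hdp (by simp; omega) ?_ ?_
    · rintro ⟨j, t⟩ u
      fin_cases t
      · exact hCC _ _ _
      · exact hC _ _
      · simpa [w] using hC _ _
    · rintro ⟨j, t⟩
      fin_cases t
      · exact hBB _ _
      · exact hB _
      · simpa [b] using hB _
  let s : Fin 3 → ℝ := ![1, 1, -1]
  have hs : ∀ t, |s t| ≤ 1 := by intro t; fin_cases t <;> simp [s]
  refine ⟨Fin ((m + 1) / 2) × Fin 3, inferInstance, F', fun j q => if q.1 = j then s q.2 else 0,
    fun _ => 0, hF', ?_, ?_, fun _ => by simp; linarith, fun _ _ => by simp; linarith, ?_⟩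
  · intro j q
    dsimp only
    split_ifs
    · exact (hs _).trans hc
    · simp; linarith
  · intro j j' q
    have h1 := (hs q.2).trans hc
    dsimp only
    split_ifs <;> simp <;> linarith
  · intro x
    have hval : ∀ j, (∑ q : Fin ((m + 1) / 2) × Fin 3, (if q.1 = j then s q.2 else 0) * F' q x) + 0
        = max ((∑ u, C (α j) u * F u x) + B (α j)) ((∑ u, C (β j) u * F u x) + B (β j)) := by
      intro j
      rw [add_zero, Fintype.sum_prod_type, Finset.sum_eq_single j]
      · rw [← relu_sub_add_relu_sub_relu_neg]
        simp only [Fin.sum_univ_three, if_true, s, F', hφ, w, b]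
        simp only [Matrix.cons_val_zero, Matrix.cons_val_one, Matrix.cons_val]
        have e1 : (∑ u, (C (α j) u - C (β j) u) * F u x) + (B (α j) - B (β j))
            = ((∑ u, C (α j) u * F u x) + B (α j)) - ((∑ u, C (β j) u * F u x) + B (β j)) := by
          rw [add_sub_add_comm, ← Finset.sum_sub_distrib]; simp only [sub_mul]
        have e2 : (∑ u, -C (β j) u * F u x) + -B (β j)
            = -((∑ u, C (β j) u * F u x) + B (β j)) := by
          rw [neg_add, ← Finset.sum_neg_distrib]; simp only [neg_mul]
        rw [e1, e2]; ring
      · intro j' _ hj'; simp [hj']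
      · simp
    simp only [hval]
    obtain ⟨⟨i, hi⟩, hub⟩ := hmax x
    have hub' : ∀ j, (∑ u, C j u * F u x) + B j ≤ T x := fun j => hub ⟨j, rfl⟩
    refine ⟨?_, ?_⟩
    · obtain ⟨j, hj⟩ := hsurj i
      refine ⟨j, ?_⟩
      dsimp only at hi ⊢
      rcases hj with hj | hj
      · rw [hj, hi]; exact max_eq_left (hub' _)
      · rw [hj, hi]; exact max_eq_right (hub' _)
    · rintro _ ⟨j, rfl⟩
      exact max_le (hub' _) (hub' _)

/-- The first layer computes the positive and negative parts of all `x i - z j i`. -/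
lemma maxRealizable_one {dp : ℕ} {l : ℕ → ℕ} {φ : ℕ → ℝ → ℝ} {c K : ℝ} {m : ℕ} (hc : 1 ≤ c)
    (hdp : paramCount l 1 ≤ dp) (hφ : φ 1 = relu) (hl : 2 * l 0 * m ≤ l 1) (hK : 0 ≤ K)
    (hKc : K ≤ c)
    {z : Fin m → Fin (l 0) → ℝ} (hz : ∀ j i, |z j i| ≤ c) {g : Fin m → ℝ} (hg : ∀ j, |g j| ≤ c)
    (hgg : ∀ j j', |g j - g j'| ≤ c) {T : (Fin (l 0) → ℝ) → ℝ}
    (hT : ∀ x, IsGreatest (Set.range fun j => g j - K * ∑ i, |x i - z j i|) (T x)) :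
    MaxRealizable dp l φ c 1 m T := by
  let s : Fin 2 → ℝ := ![1, -1]
  have hs : ∀ t, |s t| = 1 := by intro t; fin_cases t <;> simp [s]
  let F : Fin m × Fin (l 0) × Fin 2 → (Fin (l 0) → ℝ) → ℝ := fun q x =>
    φ 1 ((∑ i, (if q.2.1 = i then s q.2.2 else 0) * x i) + -(s q.2.2 * z q.1 q.2.1))
  have hF : Realizable dp l φ c 1 F := by
    refine (realizable_zero dp l φ (by linarith)).succ (by linarith) hdp ?_ ?_ ?_
    · simp; linarith
    · intro q i
      split_ifs
      · rw [hs]; exact hc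
      · simp; linarith
    · intro q
      rw [abs_neg, abs_mul, hs, one_mul]; exact hz _ _
  have hK' : |K| ≤ c := by rwa [abs_of_nonneg hK]
  refine ⟨_, inferInstance, F, fun j q => if q.1 = j then -K else 0, g, hF, ?_, ?_, hg, hgg, ?_⟩
  · intro j q
    dsimp only
    split_ifs
    · simpa using hK'
    · simp; linarith
  · intro j j' q
    dsimp only
    split_ifs <;> simp <;> linarith
  · intro x
    convert hT x using 3 with j
    rw [add_comm, sub_eq_add_neg]
    congr 1
    rw [Fintype.sum_prod_type, Finset.sum_eq_single j]
    · simp only [if_true]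
      rw [Fintype.sum_prod_type, Finset.mul_sum, ← Finset.sum_neg_distrib]
      refine Finset.sum_congr rfl fun i _ => ?_
      simp only [F, hφ, Fin.sum_univ_two, ite_mul, zero_mul, Finset.sum_ite_eq, Finset.mem_univ,
        if_true]
      rw [← relu_add_relu_neg]
      simp only [s, Matrix.cons_val_zero, Matrix.cons_val_one]
      ring_nf
    · intro j' _ hj'; simp [hj']
    · simp

/-- The clipping layer on top of a representation of `T` itself. -/
lemma MaxRealizable.exists_network {dp : ℕ} {l : ℕ → ℕ} {φ : ℕ → ℝ → ℝ} {c : ℝ} {k : ℕ}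
    {T : (Fin (l 0) → ℝ) → ℝ} (hT : MaxRealizable dp l φ c k 1 T) (hc : 0 ≤ c)
    (hdp : paramCount l (k + 1) ≤ dp) (hl : l (k + 1) = 1) :
    ∃ θ : Fin dp → ℝ, (∀ i, |θ i| ≤ c) ∧
      ∀ x i, componentwiseNetwork l φ θ (k + 1) x i = φ (k + 1) (T x) := by
  obtain ⟨κ, _, F, C, B, hF, hC, -, hB, -, hmax⟩ := hT
  obtain ⟨θ, hθ, e, he⟩ := hF.succ hc hdp (ι' := Fin 1) (by simp [hl]) hC hB
  refine ⟨θ, hθ, fun x i => ?_⟩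
  have : Subsingleton (Fin (l (k + 1))) := by rw [hl]; infer_instance
  rw [Subsingleton.elim i (e 0), he]
  obtain ⟨j, hj⟩ := (hmax x).1
  rw [← hj, Subsingleton.elim j 0]

lemma exists_network_const {dp : ℕ} {l : ℕ → ℕ} {φ : ℕ → ℝ → ℝ} {c y : ℝ} {k : ℕ}
    (hy : |y| ≤ c) (hdp : paramCount l (k + 1) ≤ dp) (hl : l (k + 1) = 1) :
    ∃ θ : Fin dp → ℝ, (∀ i, |θ i| ≤ c) ∧
      ∀ x i, componentwiseNetwork l φ θ (k + 1) x i = φ (k + 1) y := by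
  have hc : 0 ≤ c := (abs_nonneg y).trans hy
  refine MaxRealizable.exists_network (T := fun _ => y) ⟨Fin 0, inferInstance, fun _ _ => 0,
    fun _ _ => 0, fun _ => y, ⟨0, fun _ => by simpa using hc, ⟨Fin.elim0, fun i => i.elim0⟩,
      fun _ i => i.elim0⟩, by simp, by simp, by simpa using hy, by simpa using hc, ?_⟩ hc hdp hl
  intro x
  simp

lemma MaxRealizable.iterate {dp L : ℕ} {l : ℕ → ℕ} {φ : ℕ → ℝ → ℝ} {c y : ℝ} {m : ℕ}
    {T : (Fin (l 0) → ℝ) → ℝ} (hT : MaxRealizable dp l φ c 1 m T) (hc : 1 ≤ c)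
    (hdp : paramCount l L ≤ dp) (hφ : ∀ k < L, φ k = relu) (hm1 : 1 ≤ m) (hm : (m : ℝ) ≤ y)
    (hl : ∀ j, j + 2 < L → 3 * ⌈y / 2 ^ (j + 1)⌉₊ ≤ l (j + 2)) (j : ℕ) (hj : j + 1 < L) :
    ∃ m', 1 ≤ m' ∧ m' ≤ ⌈y / 2 ^ j⌉₊ ∧ MaxRealizable dp l φ c (j + 1) m' T := by
  induction j with
  | zero => exact ⟨m, hm1, by simpa using Nat.cast_le.1 (hm.trans (Nat.le_ceil y)), hT⟩
  | succ j ih =>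
    obtain ⟨m', h1, h2, h3⟩ := ih (by omega)
    have h4 : ⌈y / 2 ^ j⌉₊ ≤ 2 * ⌈y / 2 ^ (j + 1)⌉₊ := by
      rw [Nat.ceil_le]
      push_cast
      have := Nat.le_ceil (y / 2 ^ (j + 1))
      rw [pow_succ, ← div_div] at this ⊢
      linarith
    have h5 := hl j hj
    refine ⟨(m' + 1) / 2, by omega, by omega, h3.succ hc
      ((paramCount_mono l (by omega)).trans hdp) (hφ _ hj) ?_⟩
    show _ ≤ l (j + 2)
    omega

/-! ### Uniform grids -/

/-- The midpoint of the `j`-th of `n` subintervals of equal length of `[a, b]`. -/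
noncomputable def gridPoint (a b : ℝ) {n : ℕ} (j : Fin n) : ℝ := a + (b - a) * (2 * j + 1) / (2 * n)

lemma gridPoint_mem_Icc {a b : ℝ} (hab : a ≤ b) {n : ℕ} (j : Fin n) :
    gridPoint a b j ∈ Set.Icc a b := by
  have hn : (0 : ℝ) < n := by exact_mod_cast j.pos
  have hj : (j : ℝ) + 1 ≤ n := by exact_mod_cast j.2
  have hj0 : (0 : ℝ) ≤ j := by positivity
  have h0 : 0 ≤ b - a := by linarith
  unfold gridPoint
  constructor
  · have : 0 ≤ (b - a) * (2 * j + 1) / (2 * n) := by positivity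
    linarith
  · have : (b - a) * (2 * j + 1) / (2 * n) ≤ b - a := by
      rw [div_le_iff₀ (by positivity)]
      exact mul_le_mul_of_nonneg_left (by linarith) h0
    linarith

lemma exists_gridPoint_near {a b : ℝ} (hab : a < b) {n : ℕ} (hn : 1 ≤ n) {x : ℝ}
    (hx : x ∈ Set.Icc a b) : ∃ j : Fin n, |x - gridPoint a b j| ≤ (b - a) / (2 * n) := by
  have h0 : 0 < b - a := by linarith
  have hn' : (0 : ℝ) < n := by exact_mod_cast hn
  set t := (x - a) / (b - a) * n with ht
  have ht0 : 0 ≤ t := mul_nonneg (div_nonneg (by linarith [hx.1]) h0.le) hn'.le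
  have htn : t ≤ n := by
    rw [ht]
    refine mul_le_of_le_one_left hn'.le ?_
    rw [div_le_one h0]; linarith [hx.2]
  have hj : ∃ j : Fin n, |t - (j + 1 / 2)| ≤ 1 / 2 := by
    rcases htn.eq_or_lt with h | h
    · refine ⟨⟨n - 1, by omega⟩, ?_⟩
      rw [h]
      push_cast [Nat.cast_sub hn]
      rw [abs_le]; constructor <;> linarith
    · refine ⟨⟨⌊t⌋₊, (Nat.floor_lt ht0).2 h⟩, ?_⟩
      have h1 := Nat.floor_le ht0
      have h2 := Nat.lt_floor_add_one t
      simp only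
      rw [abs_le]; constructor <;> linarith
  obtain ⟨j, hj⟩ := hj
  refine ⟨j, ?_⟩
  have key : x - gridPoint a b j = (b - a) / n * (t - (j + 1 / 2)) := by
    rw [ht, gridPoint]; field_simp; ring
  rw [key, abs_mul, abs_of_nonneg (by positivity)]
  calc (b - a) / n * |t - (j + 1 / 2)| ≤ (b - a) / n * (1 / 2) := by gcongr
    _ = (b - a) / (2 * n) := by field_simp

/-! ### Approximation of Lipschitz functions by clipped networks -/

lemma abs_clip_sub_le_of_mem {u v y : ℝ} (hy : y ∈ Set.Icc u v) (t : ℝ) :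
    |clip u v t - y| ≤ |t - y| := by
  have := abs_clip_sub_le u v t y
  rwa [clip_eq_self hy] at this

/-- The lower McShane extension of the values of a Lipschitz function on an `r`-net is within
`2 K r` of the function. -/
lemma abs_isGreatest_sub_le {ι n : Type*} [Fintype n] {S : Set (n → ℝ)} {E : (n → ℝ) → ℝ}
    {K r t : ℝ} (hK : 0 ≤ K) (hE : ∀ x ∈ S, ∀ y ∈ S, |E x - E y| ≤ K * ∑ i, |x i - y i|)
    {z : ι → n → ℝ} (hz : ∀ j, z j ∈ S) {x : n → ℝ} (hx : x ∈ S)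
    (hr : ∃ j, ∑ i, |x i - z j i| ≤ r)
    (ht : IsGreatest (Set.range fun j => E (z j) - K * ∑ i, |x i - z j i|) t) :
    |t - E x| ≤ 2 * (K * r) := by
  obtain ⟨j₀, hj₀⟩ := hr
  obtain ⟨⟨j₁, hj₁⟩, hub⟩ := ht
  have h1 := (abs_le.1 (hE x hx _ (hz j₁))).1
  have h2 : E (z j₀) - K * ∑ i, |x i - z j₀ i| ≤ t := hub ⟨j₀, rfl⟩
  have h3 := (abs_le.1 (hE x hx _ (hz j₀))).2
  have h4 := mul_le_mul_of_nonneg_left hj₀ hK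
  have h5 : 0 ≤ K * r :=
    mul_nonneg hK ((Finset.sum_nonneg fun i _ => abs_nonneg _).trans hj₀)
  dsimp only at hj₁
  rw [abs_le]; constructor <;> linarith

lemma two_mul_le_two_pow {d : ℕ} (hd : 1 ≤ d) : 2 * d ≤ 2 ^ d := by
  induction d, hd using Nat.le_induction with
  | base => norm_num
  | succ k hk ih => rw [pow_succ]; omega

/-- If `A > 6 ^ d`, then grids with `n ^ d ≤ A / (2 d)` points have enough points per coordinate;
this is where `6` comes from. -/
lemma exists_grid_size {d : ℕ} (hd : 1 ≤ d) {A : ℝ} (hA : (6 : ℝ) ^ d < A) :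
    ∃ n : ℕ, 1 ≤ n ∧ (n : ℝ) ^ d ≤ A / (2 * d) ∧ A ^ (1 / (d : ℝ)) ≤ 3 * n := by
  have hd' : (0 : ℝ) < d := by exact_mod_cast hd
  have h2d : (2 * d : ℝ) ≤ 2 ^ d := by exact_mod_cast two_mul_le_two_pow hd
  have hA0 : 0 < A := lt_trans (by positivity) hA
  set y := A / (2 * d) with hy
  have hy0 : 0 < y := by positivity
  have hy3 : (3 : ℝ) ^ d ≤ y := by
    rw [hy, le_div_iff₀ (by positivity)]
    calc (3 : ℝ) ^ d * (2 * d) ≤ 3 ^ d * 2 ^ d := by gcongr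
      _ = 6 ^ d := by rw [← mul_pow]; norm_num
      _ ≤ A := hA.le
  have hAy : A ≤ 2 ^ d * y := by
    rw [hy, mul_div_assoc', le_div_iff₀ (by positivity)]
    nlinarith
  have hroot : ∀ q : ℝ, 0 ≤ q → (q ^ d) ^ (1 / (d : ℝ)) = q := fun q hq => by
    rw [one_div]; exact Real.pow_rpow_inv_natCast hq (by omega)
  set z := y ^ (1 / (d : ℝ)) with hz
  have hz3 : 3 ≤ z := by
    rw [← hroot 3 (by norm_num), hz]
    exact Real.rpow_le_rpow (by positivity) hy3 (by positivity)
  have hAz : A ^ (1 / (d : ℝ)) ≤ 2 * z := by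
    rw [← hroot 2 (by norm_num), hz, ← Real.mul_rpow (by positivity) hy0.le]
    exact Real.rpow_le_rpow hA0.le hAy (by positivity)
  have h1 := Nat.floor_le (by linarith : 0 ≤ z)
  have h2 := Nat.lt_floor_add_one z
  refine ⟨⌊z⌋₊, Nat.le_floor (by norm_num; linarith), ?_, by linarith⟩
  calc (⌊z⌋₊ : ℝ) ^ d ≤ z ^ d := by gcongr
    _ = y := by rw [hz, one_div]; exact Real.rpow_inv_natCast_pow hy0.le (by omega)

lemma sq_le_of_abs_le_div {d : ℕ} {A C t : ℝ} (hA : 0 < A)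
    (ht : |t| ≤ 3 * C / A ^ (1 / (d : ℝ))) : |t| ^ 2 ≤ 9 * C ^ 2 / A ^ (2 / (d : ℝ)) := by
  have h : A ^ (2 / (d : ℝ)) = (A ^ (1 / (d : ℝ))) ^ 2 := by
    rw [← Real.rpow_natCast, ← Real.rpow_mul hA.le]; congr 1; push_cast; ring
  calc |t| ^ 2 ≤ (3 * C / A ^ (1 / (d : ℝ))) ^ 2 := by gcongr
    _ = _ := by rw [h, div_pow]; ring

/-- A Lipschitz function with values in `[u, v]` is approximated on the cube by a clipped network
with parameters in `[-c, c]`: by a constant if `A ≤ 6 ^ d`, and otherwise by its lower McShane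
extension from a grid, whose maximum is computed by a binary tree. -/
theorem exists_scalarNetwork_approx {d dp L : ℕ} (hd : 1 ≤ d) (hL : 1 ≤ L)
    {A Lip a b u v c : ℝ} (hA : 0 < A) (hLip : 0 ≤ Lip) (hab : a < b)
    (hc : max 1 (max (2 * |u|) (max (2 * |v|) (max |a| (max |b| Lip)))) ≤ c)
    {l : ℕ → ℕ} (hl0 : l 0 = d) (hlL : l L = 1)
    (hdepth : 1 + ((⌈Real.logb 2 (A / (2 * d))⌉ : ℝ) + 1) *
      (Set.Ioi ((6 : ℝ) ^ d)).indicator 1 A ≤ (L : ℝ))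
    (hl1 : A * (Set.Ioi ((6 : ℝ) ^ d)).indicator 1 A ≤ (l 1 : ℝ))
    (hli : ∀ i, 2 ≤ i → i < L →
      3 * (⌈A / (2 ^ i * d)⌉ : ℝ) * (Set.Ioi ((6 : ℝ) ^ d)).indicator 1 A ≤ (l i : ℝ))
    (hparam : paramCount l L ≤ dp)
    {E : (Fin d → ℝ) → ℝ} (hE : ∀ x ∈ cube d a b, E x ∈ Set.Icc u v)
    (hELip : ∀ x ∈ cube d a b, ∀ y ∈ cube d a b, |E x - E y| ≤ Lip * ∑ i, |x i - y i|) :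
    ∃ θ : Fin dp → ℝ, (∀ i, |θ i| ≤ c) ∧ ∀ x ∈ cube d a b,
      |scalarNetwork l L hl0 hlL u v θ x - E x| ^ 2
        ≤ 9 * (d : ℝ) ^ 2 * Lip ^ 2 * (b - a) ^ 2 / A ^ (2 / (d : ℝ)) := by
  simp only [max_le_iff] at hc
  obtain ⟨hc1, hcu, hcv, hca, hcb, hcL⟩ := hc
  have hd' : (0 : ℝ) < d := by exact_mod_cast hd
  have habs : ∀ y ∈ Set.Icc u v, 2 * |y| ≤ c := fun y hy => by
    have := abs_le_max_abs_abs hy.1 hy.2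
    rcases max_cases |u| |v| with h | h <;> linarith [h.1]
  have habs' : ∀ y ∈ Set.Icc a b, |y| ≤ c := fun y hy =>
    (abs_le_max_abs_abs hy.1 hy.2).trans (max_le hca hcb)
  subst hl0
  -- a grid with `n` points per coordinate yields an `r`-net with `r = d (b - a) / (2 n)`
  have hgrid : ∀ n : ℕ, 1 ≤ n → ∀ x ∈ cube (l 0) a b, ∃ j : Fin (l 0) → Fin n,
      ∑ i, |x i - gridPoint a b (j i)| ≤ l 0 * ((b - a) / (2 * n)) := by
    intro n hn x hx
    choose j hj using fun i => exists_gridPoint_near hab hn (x := x i) ⟨hx.1 i, hx.2 i⟩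
    exact ⟨j, (Finset.sum_le_card_nsmul _ _ _ fun i _ => hj i).trans (by simp)⟩
  have hmem : ∀ {n : ℕ} (j : Fin (l 0) → Fin n), (fun i => gridPoint a b (j i)) ∈ cube (l 0) a b :=
    fun j => ⟨fun i => (gridPoint_mem_Icc hab.le (j i)).1,
      fun i => (gridPoint_mem_Icc hab.le (j i)).2⟩
  have hout : ∀ T : ℝ, activation L u v L T = clip u v T := fun T => if_pos rfl
  rw [show 9 * (l 0 : ℝ) ^ 2 * Lip ^ 2 * (b - a) ^ 2 = 9 * (Lip * l 0 * (b - a)) ^ 2 by ring]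
  have hb0 : 0 ≤ b - a := by linarith
  by_cases hbig : (6 : ℝ) ^ (l 0) < A
  · rw [Set.indicator_of_mem (by exact hbig), Pi.one_apply, mul_one] at hdepth hl1
    have hli' : ∀ i, 2 ≤ i → i < L → 3 * (⌈A / (2 ^ i * l 0)⌉ : ℝ) ≤ (l i : ℝ) := by
      intro i h2 hi
      have := hli i h2 hi
      rwa [Set.indicator_of_mem (by exact hbig), Pi.one_apply, mul_one] at this
    obtain ⟨n, hn1, hny, hAn⟩ := exists_grid_size hd hbig
    have hn0 : (0 : ℝ) < n := by exact_mod_cast hn1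
    set y := A / (2 * (l 0 : ℝ)) with hy
    set m := Fintype.card (Fin (l 0) → Fin n) with hm
    have hmn : m = n ^ l 0 := by simp [hm]
    have hmy : (m : ℝ) ≤ y := by rw [hmn]; exact_mod_cast hny
    have hm1 : 1 ≤ m := by rw [hmn]; exact Nat.one_le_pow _ _ hn1
    have hy0 : 0 < y := by positivity
    have hyL : y ≤ 2 ^ (L - 2 : ℝ) := by
      have h1 := Int.le_ceil (Real.logb 2 y)
      rw [← Real.logb_le_iff_le_rpow (by norm_num) hy0]
      linarith
    have hL2 : 2 ≤ L := by
      have h1 : (1 : ℝ) ≤ y := le_trans (by exact_mod_cast hm1) hmy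
      have h2 := Real.logb_nonneg (b := 2) (by norm_num) h1
      have h3 := Int.le_ceil (Real.logb 2 y)
      have : (2 : ℝ) ≤ L := by linarith
      exact_mod_cast this
    obtain ⟨k, rfl⟩ : ∃ k, L = k + 2 := ⟨L - 2, by omega⟩
    have hyk : y ≤ 2 ^ k := by
      rw [← Real.rpow_natCast]
      convert hyL using 2
      push_cast; ring
    let e := Fintype.equivFin (Fin (l 0) → Fin n)
    let z : Fin m → Fin (l 0) → ℝ := fun j i => gridPoint a b (e.symm j i)
    have hz : ∀ j, z j ∈ cube (l 0) a b := fun j => hmem _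
    have hT : ∀ x : Fin (l 0) → ℝ, ∃ t, IsGreatest
        (Set.range fun j => E (z j) - Lip * ∑ i, |x i - z j i|) t := by
      intro x
      have : Nonempty (Fin m) := ⟨⟨0, hm1⟩⟩
      obtain ⟨j, hj⟩ := Finite.exists_max fun j => E (z j) - Lip * ∑ i, |x i - z j i|
      exact ⟨_, ⟨j, rfl⟩, by rintro _ ⟨i, rfl⟩; exact hj i⟩
    choose T hT using hT
    have hφ : ∀ i < k + 2, activation (k + 2) u v i = relu := by
      intro i hi; funext t; exact if_neg hi.ne
    have hstart : MaxRealizable dp l (activation (k + 2) u v) c 1 m T := by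
      refine maxRealizable_one hc1 ((paramCount_mono l (by omega)).trans hparam) (hφ 1 (by omega))
        ?_ hLip hcL (fun j i => habs' _ ⟨(hz j).1 i, (hz j).2 i⟩)
        (fun j => ?_) (fun j j' => ?_) hT
      · have h1 : (2 * l 0 * m : ℝ) ≤ A := by
          rw [hy, le_div_iff₀ (by positivity)] at hmy; linarith
        exact_mod_cast h1.trans hl1
      · have := habs _ (hE _ (hz j))
        linarith [abs_nonneg (E (z j))]
      · have h1 := habs _ (hE _ (hz j))
        have h2 := habs _ (hE _ (hz j'))
        linarith [abs_sub (E (z j)) (E (z j'))]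
    obtain ⟨m', hm1', hm', hfin⟩ := hstart.iterate hc1 hparam hφ hm1 hmy (fun j hj => by
      have h1 := hli' (j + 2) (by omega) hj
      have h2 : A / (2 ^ (j + 2) * (l 0 : ℝ)) = y / 2 ^ (j + 1) := by
        rw [hy, pow_succ 2 (j + 1)]; field_simp
      rw [h2, ← natCast_ceil_eq_intCast_ceil (by positivity)] at h1
      exact_mod_cast h1) k (by omega)
    have hm'1 : m' = 1 := by
      have : ⌈y / 2 ^ k⌉₊ ≤ 1 := by
        rw [Nat.ceil_le, Nat.cast_one, div_le_one (by positivity)]; exact hyk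
      omega
    subst hm'1
    obtain ⟨θ, hθ, hnet⟩ := hfin.exists_network (by linarith) hparam hlL
    refine ⟨θ, hθ, fun x hx => ?_⟩
    rw [scalarNetwork_eq, hnet, hout]
    apply sq_le_of_abs_le_div hA
    refine (abs_clip_sub_le_of_mem (hE x hx) _).trans ?_
    obtain ⟨j, hj⟩ := hgrid n hn1 x hx
    refine (abs_isGreatest_sub_le hLip hELip hz hx ⟨e j, by simpa [z] using hj⟩ (hT x)).trans ?_
    calc 2 * (Lip * (l 0 * ((b - a) / (2 * n)))) = 3 * (Lip * l 0 * (b - a)) / (3 * n) := by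
          field_simp
      _ ≤ _ := by
          apply div_le_div_of_nonneg_left (by positivity) (by positivity) hAn
  · obtain ⟨j, -⟩ := hgrid 1 le_rfl (fun _ => a) ⟨le_rfl, fun _ => hab.le⟩
    obtain ⟨k, rfl⟩ : ∃ k, L = k + 1 := ⟨L - 1, by omega⟩
    set y := E fun i => gridPoint a b (j i) with hy
    have hyuv : y ∈ Set.Icc u v := hE _ (hmem j)
    obtain ⟨θ, hθ, hnet⟩ := exists_network_const (dp := dp) (l := l)
      (φ := activation (k + 1) u v) (c := c) (y := y) (k := k)
      (by have := habs _ hyuv; linarith [abs_nonneg y]) hparam hlL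
    refine ⟨θ, hθ, fun x hx => ?_⟩
    rw [scalarNetwork_eq, hnet, hout]
    apply sq_le_of_abs_le_div hA
    refine (abs_clip_sub_le_of_mem (hE x hx) _).trans ?_
    rw [abs_sub_comm]
    obtain ⟨j', hj'⟩ := hgrid 1 le_rfl x hx
    rw [Subsingleton.elim j' j] at hj'
    refine (hELip x hx _ (hmem j)).trans ((mul_le_mul_of_nonneg_left hj' hLip).trans ?_)
    have hA6 : A ^ (1 / (l 0 : ℝ)) ≤ 6 := by
      rw [← Real.pow_rpow_inv_natCast (x := 6) (n := l 0) (by norm_num) (by omega), one_div]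
      exact Real.rpow_le_rpow hA.le (not_lt.1 hbig) (by positivity)
    rw [le_div_iff₀ (by positivity)]
    calc Lip * (l 0 * ((b - a) / (2 * (1 : ℕ)))) * A ^ (1 / (l 0 : ℝ))
        ≤ Lip * (l 0 * ((b - a) / (2 * (1 : ℕ)))) * 6 := by gcongr
      _ = 3 * (Lip * l 0 * (b - a)) := by push_cast; ring

/-! ### The minimal distance of independent uniform parameters to a given one -/

/-- The maximum distance of the first `D` entries of two parameter vectors. -/
noncomputable def paramDist {dp : ℕ} (D : ℕ) (θ θ' : Fin dp → ℝ) : ℝ :=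
  ((Finset.range D).sup fun t => ‖param θ t - param θ' t‖₊ : NNReal)

lemma paramDist_nonneg {dp : ℕ} (D : ℕ) (θ θ' : Fin dp → ℝ) : 0 ≤ paramDist D θ θ' :=
  NNReal.coe_nonneg _

lemma paramDist_le_iff {dp D : ℕ} {θ θ' : Fin dp → ℝ} {r : ℝ} (hr : 0 ≤ r) :
    paramDist D θ θ' ≤ r ↔ ∀ t < D, |param θ t - param θ' t| ≤ r := by
  lift r to NNReal using hr
  simp only [paramDist, NNReal.coe_le_coe, Finset.sup_le_iff, Finset.mem_range,
    ← Real.norm_eq_abs, ← coe_nnnorm]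

lemma measurable_paramDist {dp : ℕ} (D : ℕ) (θ' : Fin dp → ℝ) :
    Measurable fun θ => paramDist D θ θ' := by
  unfold paramDist
  refine measurable_coe_nnreal_real.comp ?_
  induction D with
  | zero => simp
  | succ D ih =>
    simp only [Finset.range_add_one, Finset.sup_insert]
    exact (((measurable_param D).sub measurable_const).nnnorm).sup ih

lemma volume_cube {dp : ℕ} (c : ℝ) :
    volume (cube dp (-c) c) = ENNReal.ofReal (2 * c) ^ dp := by
  rw [cube, Real.volume_Icc_pi]
  simp [two_mul]

/-- Shrinking the first `D` edges of `[-c, c]^𝐝` by the factor `t` towards `θ'` gives a box inside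
the cube. -/
lemma ofReal_pow_mul_volume_cube_le {dp D : ℕ} (hD : D ≤ dp) {c t : ℝ} (hc : 0 ≤ c)
    (ht0 : 0 ≤ t) (ht1 : t ≤ 1) {θ' : Fin dp → ℝ} (hθ' : ∀ i, |θ' i| ≤ c) :
    ENNReal.ofReal (t ^ D) * volume (cube dp (-c) c)
      ≤ volume (cube dp (-c) c ∩ {θ | paramDist D θ θ' ≤ 2 * c * t}) := by
  let τ : Fin dp → ℝ := fun i => if (i : ℕ) < D then t else 1
  have hτ0 : ∀ i, 0 ≤ τ i := fun i => by simp only [τ]; split_ifs <;> linarith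
  have hτ1 : ∀ i, τ i ≤ 1 := fun i => by simp only [τ]; split_ifs <;> linarith
  have hprod : ∏ i, τ i = t ^ D := by
    simp only [τ, Finset.prod_ite, Finset.prod_const, one_pow, mul_one]
    congr 1
    rw [Fin.card_filter_val_lt]
    exact min_eq_right hD
  have hbox : volume (Set.Icc (fun i => (1 - τ i) * θ' i - τ i * c)
      fun i => (1 - τ i) * θ' i + τ i * c) = ENNReal.ofReal (t ^ D) * volume (cube dp (-c) c) := by
    rw [Real.volume_Icc_pi, volume_cube, ← hprod, ENNReal.ofReal_prod_of_nonneg fun i _ => hτ0 i,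
      show ENNReal.ofReal (2 * c) ^ dp = ∏ _i : Fin dp, ENNReal.ofReal (2 * c) by simp,
      ← Finset.prod_mul_distrib]
    refine Finset.prod_congr rfl fun i _ => ?_
    rw [← ENNReal.ofReal_mul (hτ0 i)]
    congr 1; ring
  rw [← hbox]
  refine measure_mono fun θ hθ => ⟨⟨fun i => ?_, fun i => ?_⟩, ?_⟩
  · have h1 := hθ.1 i
    have h2 := (abs_le.1 (hθ' i)).1
    have h3 := mul_le_mul_of_nonneg_left h2 (sub_nonneg.2 (hτ1 i))
    dsimp only at h1 ⊢
    linarith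
  · have h1 := hθ.2 i
    have h2 := (abs_le.1 (hθ' i)).2
    have h3 := mul_le_mul_of_nonneg_left h2 (sub_nonneg.2 (hτ1 i))
    dsimp only at h1 ⊢
    linarith
  · refine (paramDist_le_iff (by positivity)).2 fun s hs => ?_
    have hs' : s < dp := hs.trans_le hD
    have h1 := hθ.1 ⟨s, hs'⟩
    have h2 := hθ.2 ⟨s, hs'⟩
    simp only [τ, hs, if_true] at h1 h2
    simp only [param, hs', dif_pos]
    have h3 := abs_le.1 (hθ' ⟨s, hs'⟩)
    have h4 := mul_le_mul_of_nonneg_left h3.1 ht0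
    have h5 := mul_le_mul_of_nonneg_left h3.2 ht0
    rw [abs_le]; constructor <;> linarith

lemma measure_lt_paramDist_le {Ω : Type*} [MeasurableSpace Ω] {P : Measure Ω}
    [IsProbabilityMeasure P] {dp D : ℕ} (hD : D ≤ dp) {c t : ℝ} (hc : 0 < c) (ht0 : 0 ≤ t)
    {θ' : Fin dp → ℝ} (hθ' : ∀ i, |θ' i| ≤ c) {Z : Ω → Fin dp → ℝ} (hZ : Measurable Z)
    (hunif : pdf.IsUniform Z (cube dp (-c) c) P volume) :
    P {ω | 2 * c * t < paramDist D (Z ω) θ'} ≤ ENNReal.ofReal (Real.exp (-t ^ D)) := by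
  have hv0 : volume (cube dp (-c) c) ≠ 0 := by
    rw [volume_cube]; exact pow_ne_zero _ (by simpa using hc)
  have hvt : volume (cube dp (-c) c) ≠ ⊤ := by
    rw [volume_cube]; exact ENNReal.pow_ne_top ENNReal.ofReal_ne_top
  have hmeas : MeasurableSet {θ : Fin dp → ℝ | paramDist D θ θ' ≤ 2 * c * t} :=
    measurableSet_le (measurable_paramDist D θ') measurable_const
  have hcompl : {ω | 2 * c * t < paramDist D (Z ω) θ'}
      = (Z ⁻¹' {θ | paramDist D θ θ' ≤ 2 * c * t})ᶜ := by ext; simp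
  rw [hcompl, prob_compl_eq_one_sub (hZ hmeas)]
  -- for `t ≥ 1` the box for `t = 1` is the whole cube
  set s := min t 1 with hs
  have hs0 : 0 ≤ s := le_min ht0 zero_le_one
  have hle : ENNReal.ofReal (s ^ D) ≤ P (Z ⁻¹' {θ | paramDist D θ θ' ≤ 2 * c * t}) := by
    rw [hunif.measure_preimage hv0 hvt hmeas, ENNReal.le_div_iff_mul_le (.inl hv0) (.inl hvt)]
    refine (ofReal_pow_mul_volume_cube_le hD hc.le hs0 (min_le_right _ _) hθ').trans
      (measure_mono (Set.inter_subset_inter_right _ fun θ hθ => ?_))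
    exact le_trans (b := 2 * c * s) hθ
      (mul_le_mul_of_nonneg_left (min_le_left _ _) (by positivity))
  refine (tsub_le_tsub_left hle _).trans ?_
  rw [← ENNReal.ofReal_one, ← ENNReal.ofReal_sub _ (by positivity)]
  refine ENNReal.ofReal_le_ofReal ?_
  rcases le_total t 1 with h | h
  · rw [hs, min_eq_left h]
    linarith [Real.add_one_le_exp (-t ^ D)]
  · rw [hs, min_eq_right h]
    simpa using (Real.exp_pos _).le

lemma lintegral_rpow_le_of_measure_lt_le {Ω : Type*} [MeasurableSpace Ω] {P : Measure Ω}
    {f : Ω → ℝ} (hf : Measurable f) (hf0 : ∀ ω, 0 ≤ f ω)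
    {K q p : ℝ} (hK : 0 < K) (hq : 0 < q) (hp : 0 < p)
    (h : ∀ t, 0 < t → P {ω | t < f ω} ≤ ENNReal.ofReal (Real.exp (-K * t ^ q))) :
    ∫⁻ ω, ENNReal.ofReal (f ω ^ p) ∂P ≤ ENNReal.ofReal (K ^ (-p / q) * Real.Gamma (p / q + 1)) := by
  rw [lintegral_rpow_eq_lintegral_meas_lt_mul P (.of_forall hf0) hf.aemeasurable hp]
  have hq' : -1 < p - 1 := by linarith
  calc ENNReal.ofReal p * ∫⁻ t in Set.Ioi 0, P {ω | t < f ω} * ENNReal.ofReal (t ^ (p - 1))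
      ≤ ENNReal.ofReal p * ∫⁻ t in Set.Ioi 0,
          ENNReal.ofReal (t ^ (p - 1) * Real.exp (-K * t ^ q)) := by
        refine mul_le_mul_right (setLIntegral_mono' measurableSet_Ioi fun t ht => ?_) _
        rw [mul_comm, ENNReal.ofReal_mul (Real.rpow_nonneg (le_of_lt ht) _)]
        exact mul_le_mul_right (h t ht) _
    _ = ENNReal.ofReal (p * (K ^ (-p / q) * (1 / q) * Real.Gamma (p / q))) := by
        rw [← ofReal_integral_eq_lintegral_ofReal
            (integrableOn_rpow_mul_exp_neg_mul_rpow hq' hq hK)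
            ((ae_restrict_mem measurableSet_Ioi).mono fun t ht =>
              mul_nonneg (Real.rpow_nonneg (le_of_lt ht) _) (Real.exp_pos _).le),
          integral_rpow_mul_exp_neg_mul_rpow hq hq' hK, ← ENNReal.ofReal_mul hp.le,
          sub_add_cancel]
    _ = _ := by
        rw [Real.Gamma_add_one (by positivity)]
        congr 1; ring

lemma Gamma_add_one_le_one {x : ℝ} (h0 : 0 ≤ x) (h1 : x ≤ 1) : Real.Gamma (x + 1) ≤ 1 := by
  have h := Real.convexOn_Gamma.2 (show (1 : ℝ) ∈ Set.Ioi 0 by simp)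
    (show (2 : ℝ) ∈ Set.Ioi 0 by simp) (sub_nonneg.2 h1) h0 (by ring)
  simp only [smul_eq_mul, Real.Gamma_one, Real.Gamma_two] at h
  calc Real.Gamma (x + 1) = Real.Gamma ((1 - x) * 1 + x * 2) := by congr 1; ring
    _ ≤ (1 - x) * 1 + x * 1 := h
    _ = 1 := by ring

lemma Gamma_add_one_le_rpow {x p : ℝ} (h0 : 0 ≤ x) (hxp : x ≤ p) (hp : 1 ≤ p) :
    Real.Gamma (x + 1) ≤ p ^ x := by
  obtain ⟨n, hn⟩ := exists_nat_ge x
  induction n generalizing x with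
  | zero =>
    have : x = 0 := le_antisymm (by simpa using hn) h0
    simp [this]
  | succ n ih =>
    rcases le_total x 1 with h1 | h1
    · exact (Gamma_add_one_le_one h0 h1).trans (Real.one_le_rpow hp h0)
    · have h2 := ih (x := x - 1) (by linarith) (by linarith) (by push_cast at hn; linarith)
      rw [sub_add_cancel] at h2
      rw [Real.Gamma_add_one (by linarith)]
      have hp0 : 0 < p := by linarith
      calc x * Real.Gamma x ≤ p * p ^ (x - 1) := by
            refine mul_le_mul hxp h2 (Real.Gamma_pos_of_pos (by linarith)).le hp0.le
        _ = p ^ x := by rw [Real.rpow_sub_one hp0.ne']; field_simp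

/-- The probability that `K` independent uniform parameters all have distance more than `2 c t` from
`θ'` is at most `(1 - t ^ D) ^ K ≤ exp (-K t ^ D)`; integrating the tails gives a Gamma function. -/
theorem lintegral_inf_paramDist_rpow_le {Ω : Type*} [MeasurableSpace Ω] {P : Measure Ω}
    [IsProbabilityMeasure P] {ι : Type*} [Fintype ι] [Nonempty ι] {dp D : ℕ}
    (hD1 : 1 ≤ D) (hD : D ≤ dp) {c p : ℝ} (hc : 0 < c) (hp : 1 ≤ p) {θ' : Fin dp → ℝ}
    (hθ' : ∀ i, |θ' i| ≤ c) {Z : ι → Ω → Fin dp → ℝ} (hZ : ∀ k, Measurable (Z k))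
    (hindep : iIndepFun Z P) (hunif : ∀ k, pdf.IsUniform (Z k) (cube dp (-c) c) P volume) :
    (∫⁻ ω, ENNReal.ofReal (Finset.univ.inf' Finset.univ_nonempty
        fun k => paramDist D (Z k ω) θ') ^ p ∂P) ^ (1 / p)
      ≤ ENNReal.ofReal (2 * c * p / (Fintype.card ι : ℝ) ^ (1 / (D : ℝ))) := by
  set K : ℝ := (Fintype.card ι : ℝ) with hK
  have hK0 : 0 < K := by rw [hK]; exact_mod_cast Fintype.card_pos
  have hD0 : (0 : ℝ) < D := by exact_mod_cast hD1
  have hp0 : 0 < p := by linarith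
  let m : Ω → ℝ := fun ω => Finset.univ.inf' Finset.univ_nonempty fun k => paramDist D (Z k ω) θ'
  have hm0 : ∀ ω, 0 ≤ m ω := fun ω => Finset.le_inf' _ _ fun k _ => paramDist_nonneg _ _ _
  have hmeas : Measurable m := by
    simp only [m, Finset.inf'_univ_eq_ciInf]
    exact Measurable.iInf fun k => (measurable_paramDist D θ').comp (hZ k)
  have htail : ∀ t : ℝ, 0 < t →
      P {ω | t < m ω / (2 * c)} ≤ ENNReal.ofReal (Real.exp (-K * t ^ (D : ℝ))) := by
    intro t ht
    have hset : {ω | t < m ω / (2 * c)}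
        = ⋂ k, Z k ⁻¹' {θ | 2 * c * t < paramDist D θ θ'} := by
      ext ω
      simp only [m, Set.mem_ofPred_eq, Set.mem_iInter, Set.mem_preimage]
      rw [lt_div_iff₀ (by positivity), Finset.lt_inf'_iff]
      simp only [Finset.mem_univ, true_imp_iff, mul_comm]
    rw [hset, hindep.meas_iInter fun k => ⟨_, measurableSet_lt measurable_const
      (measurable_paramDist D θ'), rfl⟩]
    refine (Finset.prod_le_prod' fun k _ =>
      measure_lt_paramDist_le hD hc ht.le hθ' (hZ k) (hunif k)).trans ?_
    rw [Finset.prod_const, Finset.card_univ, ← ENNReal.ofReal_pow (Real.exp_pos _).le,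
      ← Real.exp_nat_mul, Real.rpow_natCast, ← hK]
    refine ENNReal.ofReal_le_ofReal (Real.exp_le_exp.2 (by linarith))
  have hmain := lintegral_rpow_le_of_measure_lt_le (hmeas.div_const (2 * c))
    (fun ω => div_nonneg (hm0 ω) (by positivity)) hK0 hD0 hp0 htail
  have hbound : K ^ (-p / D) * Real.Gamma (p / D + 1) ≤ (p / K ^ (1 / (D : ℝ))) ^ p := by
    have h1 : Real.Gamma (p / D + 1) ≤ p ^ p := by
      have hpD : p / D ≤ p := div_le_self hp0.le (by exact_mod_cast hD1)
      exact (Gamma_add_one_le_rpow (by positivity) hpD hp).trans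
        (Real.rpow_le_rpow_of_exponent_le hp hpD)
    rw [Real.div_rpow hp0.le (by positivity), ← Real.rpow_mul hK0.le, div_eq_inv_mul (p ^ p),
      ← Real.rpow_neg hK0.le, show -(1 / (D : ℝ) * p) = -p / D by ring]
    exact mul_le_mul_of_nonneg_left h1 (by positivity)
  rw [one_div, ENNReal.rpow_inv_le_iff hp0]
  have hpt : ∀ ω, ENNReal.ofReal (m ω) ^ p
      = ENNReal.ofReal ((2 * c) ^ p) * ENNReal.ofReal ((m ω / (2 * c)) ^ p) := by
    intro ω
    rw [ENNReal.ofReal_rpow_of_nonneg (hm0 ω) hp0.le, ← ENNReal.ofReal_mul (by positivity),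
      ← Real.mul_rpow (by positivity) (div_nonneg (hm0 ω) (by positivity))]
    congr 2; field_simp
  calc ∫⁻ ω, ENNReal.ofReal (m ω) ^ p ∂P
      = ENNReal.ofReal ((2 * c) ^ p) * ∫⁻ ω, ENNReal.ofReal ((m ω / (2 * c)) ^ p) ∂P := by
        simp_rw [hpt]
        exact lintegral_const_mul _ ((hmeas.div_const _).pow_const p).ennreal_ofReal
    _ ≤ ENNReal.ofReal ((2 * c) ^ p) * ENNReal.ofReal ((p / K ^ (1 / (D : ℝ))) ^ p) :=
        mul_le_mul_right (hmain.trans (ENNReal.ofReal_le_ofReal hbound)) _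
    _ = _ := by
        rw [← ENNReal.ofReal_mul (by positivity), ← Real.mul_rpow (by positivity) (by positivity),
          ENNReal.ofReal_rpow_of_nonneg (by positivity) hp0.le]
        congr 2; ring

/-! ### Moments of maxima of sub-Gaussian random variables -/

lemma lintegral_rpow_one_div_mono {Ω : Type*} [MeasurableSpace Ω] {P : Measure Ω}
    [IsProbabilityMeasure P] {f : Ω → ENNReal} (hf : AEMeasurable f P) {p q : ℝ} (hp : 0 < p)
    (hpq : p ≤ q) : (∫⁻ ω, f ω ^ p ∂P) ^ (1 / p) ≤ (∫⁻ ω, f ω ^ q ∂P) ^ (1 / q) := by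
  have h := eLpNorm'_le_eLpNorm'_of_exponent_le hp hpq P (f := f) hf.aestronglyMeasurable
  simpa [eLpNorm'] using h

lemma rpow_le_mul_exp {x s q : ℝ} (hx : 0 ≤ x) (hs : 0 < s) (hq : 0 < q) :
    x ^ q ≤ (q / (s * Real.exp 1)) ^ q * Real.exp (s * x) := by
  rcases hx.eq_or_lt with rfl | hx
  · rw [Real.zero_rpow hq.ne']; positivity
  have h1 := Real.log_le_sub_one_of_pos (show 0 < s * x / q by positivity)
  have h2 : x = q / (s * Real.exp 1) * (s * x / q * Real.exp 1) := by field_simp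
  have h3 : s * x / q * Real.exp 1 ≤ Real.exp (s * x / q) := by
    rw [← Real.exp_log (show 0 < s * x / q by positivity), ← Real.exp_add]
    rw [Real.exp_log (show 0 < s * x / q by positivity)]
    exact Real.exp_le_exp.2 (by linarith)
  calc x ^ q = (q / (s * Real.exp 1)) ^ q * (s * x / q * Real.exp 1) ^ q := by
        conv_lhs => rw [h2]
        exact Real.mul_rpow (by positivity) (by positivity)
    _ ≤ (q / (s * Real.exp 1)) ^ q * (Real.exp (s * x / q)) ^ q := by gcongr
    _ = _ := by
        rw [← Real.exp_mul]; congr 2; field_simp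

lemma lintegral_exp_mul_abs_le {Ω : Type*} [MeasurableSpace Ω] {P : Measure Ω} {Z : Ω → ℝ}
    {v : NNReal} (hZ : HasSubgaussianMGF Z v P) (s : ℝ) :
    ∫⁻ ω, ENNReal.ofReal (Real.exp (s * |Z ω|)) ∂P
      ≤ ENNReal.ofReal (2 * Real.exp (v * s ^ 2 / 2)) := by
  have hi1 := hZ.integrable_exp_mul s
  have hi2 := hZ.integrable_exp_mul (-s)
  calc ∫⁻ ω, ENNReal.ofReal (Real.exp (s * |Z ω|)) ∂P
      ≤ ∫⁻ ω, ENNReal.ofReal (Real.exp (s * Z ω) + Real.exp (-s * Z ω)) ∂P := by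
        refine lintegral_mono fun ω => ENNReal.ofReal_le_ofReal ?_
        rcases abs_cases (Z ω) with h | h
        · rw [h.1]; linarith [Real.exp_pos (-s * Z ω)]
        · rw [h.1]
          have := Real.exp_pos (s * Z ω)
          rw [show s * -Z ω = -s * Z ω by ring]; linarith
    _ = ENNReal.ofReal (mgf Z P s + mgf Z P (-s)) := by
        have h := ofReal_integral_eq_lintegral_ofReal (hi1.add hi2)
          (.of_forall fun ω => (add_pos (Real.exp_pos _) (Real.exp_pos _)).le)
        rw [mgf, mgf, ← integral_add hi1 hi2]
        exact h.symm
    _ ≤ _ := by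
        refine ENNReal.ofReal_le_ofReal ?_
        have h1 := hZ.mgf_le s
        have h2 := hZ.mgf_le (-s)
        rw [neg_sq] at h2
        linarith

/-- The `p`-th moment of the maximum is bounded by its `q`-th moment, where `q ≥ log (2 |ι|)` makes
the number of random variables contribute only a factor `exp 1`. -/
theorem lintegral_sup_abs_rpow_le {Ω : Type*} [MeasurableSpace Ω] {P : Measure Ω}
    [IsProbabilityMeasure P] {ι : Type*} [Fintype ι] [Nonempty ι] {Z : ι → Ω → ℝ} {v : NNReal}
    (hv : 0 < v) (hZ : ∀ i, HasSubgaussianMGF (Z i) v P) (hZm : ∀ i, Measurable (Z i)) {p q : ℝ}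
    (hp : 0 < p) (hpq : p ≤ q) (hq : Real.log (2 * Fintype.card ι) ≤ q) :
    (∫⁻ ω, ENNReal.ofReal (Finset.univ.sup' Finset.univ_nonempty fun i => |Z i ω|) ^ p ∂P) ^ (1 / p)
      ≤ ENNReal.ofReal √(q * v * Real.exp 1) := by
  have hq0 : 0 < q := hp.trans_le hpq
  let S : Ω → ℝ := fun ω => Finset.univ.sup' Finset.univ_nonempty fun i => |Z i ω|
  have hS0 : ∀ ω, 0 ≤ S ω := fun ω => by
    obtain ⟨i⟩ := ‹Nonempty ι›
    exact (abs_nonneg (Z i ω)).trans (Finset.le_sup' (fun i => |Z i ω|) (Finset.mem_univ i))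
  have hSm : Measurable S := by
    simp only [S, Finset.sup'_univ_eq_ciSup]
    exact Measurable.iSup fun i => (hZm i).abs
  refine (lintegral_rpow_one_div_mono hSm.ennreal_ofReal.aemeasurable hp hpq).trans ?_
  rw [one_div, ENNReal.rpow_inv_le_iff hq0]
  have hcard : (0 : ℝ) < Fintype.card ι := by exact_mod_cast Fintype.card_pos
  have hv' : (0 : ℝ) < v := by exact_mod_cast hv
  -- the optimal exponent: `v * s ^ 2 = q`
  set s : ℝ := √(q / v) with hs
  have hs0 : 0 < s := Real.sqrt_pos.2 (by positivity)
  have hs2 : s ^ 2 = q / v := Real.sq_sqrt (by positivity)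
  set C : ℝ := (q / (s * Real.exp 1)) ^ q with hC
  have hC0 : 0 ≤ C := by positivity
  have hpt : ∀ ω, ENNReal.ofReal (S ω) ^ q
      ≤ ENNReal.ofReal C * ∑ i, ENNReal.ofReal (Real.exp (s * |Z i ω|)) := by
    intro ω
    rw [ENNReal.ofReal_rpow_of_nonneg (hS0 ω) hq0.le]
    refine (ENNReal.ofReal_le_ofReal (rpow_le_mul_exp (hS0 ω) hs0 hq0)).trans ?_
    rw [ENNReal.ofReal_mul hC0]
    refine mul_le_mul_right ?_ _
    obtain ⟨i, -, hi⟩ := Finset.exists_mem_eq_sup' Finset.univ_nonempty fun i => |Z i ω|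
    simp only [S, hi]
    exact Finset.single_le_sum (f := fun i => ENNReal.ofReal (Real.exp (s * |Z i ω|)))
      (fun _ _ => zero_le) (Finset.mem_univ i)
  have hexpq : 2 * (Fintype.card ι : ℝ) ≤ Real.exp q := by
    rw [← Real.exp_log (show 0 < 2 * (Fintype.card ι : ℝ) by positivity)]
    exact Real.exp_le_exp.2 hq
  calc ∫⁻ ω, ENNReal.ofReal (S ω) ^ q ∂P
      ≤ ∫⁻ ω, ENNReal.ofReal C * ∑ i, ENNReal.ofReal (Real.exp (s * |Z i ω|)) ∂P :=
        lintegral_mono hpt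
    _ = ENNReal.ofReal C * ∑ i, ∫⁻ ω, ENNReal.ofReal (Real.exp (s * |Z i ω|)) ∂P := by
        have hm : ∀ i, Measurable fun ω => ENNReal.ofReal (Real.exp (s * |Z i ω|)) := fun i =>
          (((hZm i).abs.const_mul s).exp).ennreal_ofReal
        rw [lintegral_const_mul _ (Finset.measurable_sum _ fun i _ => hm i),
          lintegral_finsetSum _ fun i _ => hm i]
    _ ≤ ENNReal.ofReal C * ∑ _i : ι, ENNReal.ofReal (2 * Real.exp (v * s ^ 2 / 2)) := by
        gcongr with i
        exact lintegral_exp_mul_abs_le (hZ i) s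
    _ = ENNReal.ofReal (C * (2 * Fintype.card ι * Real.exp (q / 2))) := by
        rw [Finset.sum_const, Finset.card_univ, nsmul_eq_mul, ENNReal.ofReal_mul hC0,
          ← ENNReal.ofReal_natCast, ← ENNReal.ofReal_mul hcard.le, hs2,
          show (v : ℝ) * (q / v) / 2 = q / 2 by field_simp]
        congr 2; ring
    _ ≤ ENNReal.ofReal (C * (Real.exp q * Real.exp (q / 2))) := by gcongr
    _ = ENNReal.ofReal (√(q * v * Real.exp 1)) ^ q := by
        rw [ENNReal.ofReal_rpow_of_nonneg (Real.sqrt_nonneg _) hq0.le]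
        congr 1
        have h1 : Real.exp q * Real.exp (q / 2) = (Real.exp 1 * √(Real.exp 1)) ^ q := by
          rw [Real.mul_rpow (by positivity) (by positivity), Real.sqrt_eq_rpow, ← Real.exp_mul,
            ← Real.exp_mul, ← Real.exp_mul]
          congr 2 <;> ring
        rw [h1, hC, ← Real.mul_rpow (by positivity) (by positivity)]
        congr 1
        rw [Real.sqrt_mul (by positivity)]
        have h2 : √(q * v) = q / s := by
          rw [hs, Real.sqrt_mul hq0.le, Real.sqrt_div hq0.le]
          have := Real.sq_sqrt hq0.le
          have h4 := Real.sqrt_pos.2 hq0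
          field_simp
          nlinarith
        rw [h2]; field_simp

/-! ### Concentration of the empirical risk -/

/-- The empirical risk of a predictor with values in `[u, v]` is sub-Gaussian around its mean, by
Hoeffding's lemma. -/
lemma hasSubgaussianMGF_empiricalRisk_sub {Ω : Type*} [MeasurableSpace Ω] {P : Measure Ω}
    [IsProbabilityMeasure P] {d M : ℕ} (hM : 1 ≤ M) {u v : ℝ} {X : ℕ → Ω → Fin d → ℝ}
    {Y : ℕ → Ω → ℝ} (hX : ∀ j ∈ Set.Icc 1 M, Measurable (X j))
    (hYm : ∀ j ∈ Set.Icc 1 M, Measurable (Y j)) (hY : ∀ j ∈ Set.Icc 1 M, ∀ ω, Y j ω ∈ Set.Icc u v)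
    (hindep : iIndepFun (fun (j : Set.Icc 1 M) ω => (X j ω, Y j ω)) P)
    (hident : ∀ j ∈ Set.Icc 1 M,
      IdentDistrib (fun ω => (X j ω, Y j ω)) (fun ω => (X 1 ω, Y 1 ω)) P P)
    {f : (Fin d → ℝ) → ℝ} (hf : Measurable f) (hfuv : ∀ x, f x ∈ Set.Icc u v) :
    HasSubgaussianMGF (fun ω => empiricalRisk M (fun j => X j ω) (fun j => Y j ω) f
        - ∫ ω', |f (X 1 ω') - Y 1 ω'| ^ 2 ∂P)
      (Real.toNNReal (((v - u) ^ 2) ^ 2 / (4 * M))) P := by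
  let g : (Fin d → ℝ) × ℝ → ℝ := fun q => |f q.1 - q.2| ^ 2
  have hg : Measurable g := ((hf.comp measurable_fst).sub measurable_snd).abs.pow_const 2
  set m : ℝ := ∫ ω', |f (X 1 ω') - Y 1 ω'| ^ 2 ∂P with hm
  have hM0 : (0 : ℝ) < M := by exact_mod_cast hM
  have hmj : ∀ j ∈ Set.Icc 1 M, ∫ ω, g (X j ω, Y j ω) ∂P = m := fun j hj =>
    ((hident j hj).comp hg).integral_eq
  have hsub : ∀ j : Set.Icc 1 M, HasSubgaussianMGF (fun ω => g (X j ω, Y j ω) - m)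
      ((‖(v - u) ^ 2 - 0‖₊ / 2) ^ 2) P := by
    intro j
    have h := hasSubgaussianMGF_of_mem_Icc (μ := P) (X := fun ω => g (X j ω, Y j ω)) (a := 0)
      (b := (v - u) ^ 2) (hg.comp ((hX j j.2).prodMk (hYm j j.2))).aemeasurable
      (.of_forall fun ω => ?_)
    · rwa [hmj j j.2] at h
    · have h1 := hfuv (X j ω)
      have h2 := hY j j.2 ω
      refine ⟨by positivity, ?_⟩
      have : |f (X j ω) - Y j ω| ≤ v - u := by
        rw [abs_le]; constructor <;> linarith [h1.1, h1.2, h2.1, h2.2]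
      exact pow_le_pow_left₀ (abs_nonneg _) this 2
  have hind : iIndepFun (fun (j : Set.Icc 1 M) ω => g (X j ω, Y j ω) - m) P :=
    hindep.comp (fun _ q => g q - m) fun _ => hg.sub_const m
  have hsum := (HasSubgaussianMGF.sum_of_iIndepFun hind (s := Finset.univ) fun j _ =>
    hsub j).const_mul (1 / (M : ℝ))
  convert hsum using 1
  · funext ω
    have : ∑ j : Set.Icc 1 M, (g (X j ω, Y j ω) - m)
        = ∑ j ∈ Finset.Icc 1 M, (|f (X j ω) - Y j ω| ^ 2 - m) := by
      symm
      exact Finset.sum_subtype (p := (· ∈ Set.Icc 1 M)) _ (fun j => by simp)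
        fun j => |f (X j ω) - Y j ω| ^ 2 - m
    rw [this, Finset.sum_sub_distrib, empiricalRisk]
    simp
    field_simp
  · ext
    rw [Real.coe_toNNReal _ (by positivity)]
    have hcard : Fintype.card (Set.Icc 1 M) = M := by simp
    have hV : |(v - u) ^ 2| = (v - u) ^ 2 := abs_of_nonneg (sq_nonneg _)
    change _ = (1 / (M : ℝ)) ^ 2 *
      ((∑ _j : Set.Icc 1 M, (‖(v - u) ^ 2 - 0‖₊ / 2) ^ 2 : NNReal) : ℝ)
    rw [Finset.sum_const, Finset.card_univ, hcard]
    push_cast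
    rw [sub_zero, Real.norm_eq_abs, hV, nsmul_eq_mul]
    field_simp
    norm_num

/-! ### The generalization error, uniformly in the parameters -/

lemma abs_sq_sub_sq_le {u v a b y : ℝ} (ha : a ∈ Set.Icc u v) (hb : b ∈ Set.Icc u v)
    (hy : y ∈ Set.Icc u v) : |(|a - y| ^ 2 - |b - y| ^ 2)| ≤ 2 * (v - u) * |a - b| := by
  rw [sq_abs, sq_abs, show (a - y) ^ 2 - (b - y) ^ 2 = (a + b - 2 * y) * (a - b) by ring, abs_mul]
  refine mul_le_mul_of_nonneg_right ?_ (abs_nonneg _)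
  rw [abs_le]; constructor <;> linarith [ha.1, ha.2, hb.1, hb.2, hy.1, hy.2]

lemma abs_empiricalRisk_sub_le {d M : ℕ} (hM : 1 ≤ M) {u v η : ℝ} (huv : u ≤ v)
    {x : ℕ → Fin d → ℝ} {y : ℕ → ℝ} (hy : ∀ j ∈ Set.Icc 1 M, y j ∈ Set.Icc u v)
    {f g : (Fin d → ℝ) → ℝ} (hf : ∀ x, f x ∈ Set.Icc u v) (hg : ∀ x, g x ∈ Set.Icc u v)
    (hfg : ∀ j ∈ Set.Icc 1 M, |f (x j) - g (x j)| ≤ η) :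
    |empiricalRisk M x y f - empiricalRisk M x y g| ≤ 2 * (v - u) * η := by
  have hM0 : (0 : ℝ) < M := by exact_mod_cast hM
  have huv' : 0 ≤ v - u := by linarith
  unfold empiricalRisk
  rw [← mul_sub, ← Finset.sum_sub_distrib, abs_mul, abs_of_pos (by positivity),
    one_div_mul_eq_div, div_le_iff₀ hM0]
  refine (Finset.abs_sum_le_sum_abs _ _).trans
    ((Finset.sum_le_card_nsmul _ _ (2 * (v - u) * η) fun j hj => ?_).trans_eq ?_)
  · have hj' : j ∈ Set.Icc 1 M := by simpa using hj
    exact (abs_sq_sub_sq_le (hf _) (hg _) (hy j hj')).trans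
      (mul_le_mul_of_nonneg_left (hfg j hj') (by positivity))
  · simp; ring

lemma integrable_sq_loss {Ω : Type*} [MeasurableSpace Ω] {P : Measure Ω} [IsFiniteMeasure P]
    {d : ℕ} {u v : ℝ} {X : Ω → Fin d → ℝ} {Y : Ω → ℝ} (hX : Measurable X) (hYm : Measurable Y)
    (hY : ∀ ω, Y ω ∈ Set.Icc u v) {f : (Fin d → ℝ) → ℝ} (hfm : Measurable f)
    (hf : ∀ x, f x ∈ Set.Icc u v) : Integrable (fun ω => |f (X ω) - Y ω| ^ 2) P := by
  refine Integrable.of_mem_Icc 0 ((v - u) ^ 2)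
    (((hfm.comp hX).sub hYm).abs.pow_const 2).aemeasurable (.of_forall fun ω => ⟨by positivity, ?_⟩)
  have h1 := hf (X ω)
  have h2 := hY ω
  have : |f (X ω) - Y ω| ≤ v - u := by
    rw [abs_le]; constructor <;> linarith [h1.1, h1.2, h2.1, h2.2]
  exact pow_le_pow_left₀ (abs_nonneg _) this 2

lemma abs_integral_sq_loss_sub_le {Ω : Type*} [MeasurableSpace Ω] {P : Measure Ω}
    [IsProbabilityMeasure P] {d : ℕ} {u v η : ℝ} (huv : u ≤ v) {X : Ω → Fin d → ℝ} {Y : Ω → ℝ}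
    (hX : Measurable X) (hYm : Measurable Y) (hY : ∀ ω, Y ω ∈ Set.Icc u v)
    {f g : (Fin d → ℝ) → ℝ} (hfm : Measurable f) (hgm : Measurable g)
    (hf : ∀ x, f x ∈ Set.Icc u v) (hg : ∀ x, g x ∈ Set.Icc u v)
    (hfg : ∀ ω, |f (X ω) - g (X ω)| ≤ η) :
    |(∫ ω, |f (X ω) - Y ω| ^ 2 ∂P) - ∫ ω, |g (X ω) - Y ω| ^ 2 ∂P| ≤ 2 * (v - u) * η := by
  rw [← integral_sub (integrable_sq_loss hX hYm hY hfm hf) (integrable_sq_loss hX hYm hY hgm hg)]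
  have h := norm_integral_le_of_norm_le_const (μ := P)
    (f := fun ω => |f (X ω) - Y ω| ^ 2 - |g (X ω) - Y ω| ^ 2) (C := 2 * (v - u) * η)
    (.of_forall fun ω => (abs_sq_sub_sq_le (hf _) (hg _) (hY ω)).trans
      (mul_le_mul_of_nonneg_left (hfg ω) (by linarith)))
  simpa using h

/-- The parameter vector whose first `D` entries are grid points of `[-β, β]`, and whose other
entries vanish. -/
noncomputable def gridParam (dp : ℕ) {D n : ℕ} (β : ℝ) (g : Fin D → Fin n) : Fin dp → ℝ :=
  fun i => if h : (i : ℕ) < D then gridPoint (-β) β (g ⟨i, h⟩) else 0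

lemma abs_gridParam_le {dp D n : ℕ} {β : ℝ} (hβ : 0 ≤ β) (g : Fin D → Fin n) (i : Fin dp) :
    |gridParam dp β g i| ≤ β := by
  unfold gridParam; split_ifs
  · exact abs_le.2 (gridPoint_mem_Icc (by linarith) _)
  · simpa using hβ

lemma exists_gridParam_near {dp D n : ℕ} (hD : D ≤ dp) (hn : 1 ≤ n) {β : ℝ} (hβ : 0 < β)
    {θ : Fin dp → ℝ} (hθ : ∀ i, |θ i| ≤ β) :
    ∃ g : Fin D → Fin n, ∀ t < D, |param θ t - param (gridParam dp β g) t| ≤ β / n := by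
  choose g hg using fun i : Fin D => exists_gridPoint_near (a := -β) (b := β) (by linarith) hn
    (x := θ (Fin.castLE hD i)) (abs_le.1 (hθ _))
  refine ⟨g, fun t ht => ?_⟩
  have htp : t < dp := ht.trans_le hD
  have h := hg ⟨t, ht⟩
  simp only [param, htp, dif_pos, gridParam, ht]
  refine h.trans_eq ?_
  field_simp; ring

lemma paramCount_le {l : ℕ → ℕ} {L W : ℕ} (hW : ∀ k ≤ L, l k ≤ W) :
    paramCount l L ≤ L * (W + 1) ^ 2 := by
  unfold paramCount
  refine (Finset.sum_le_card_nsmul _ _ ((W + 1) ^ 2) fun j hj => ?_).trans (by simp)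
  have hj' := Finset.mem_range.1 hj
  rw [sq]
  exact Nat.mul_le_mul ((hW _ hj').trans (Nat.le_succ W)) (Nat.succ_le_succ (hW _ hj'.le))

/-- The number `n` of grid points per parameter that is needed enters only through the logarithm of
the number `n ^ D` of networks. -/
lemma log_two_mul_pow_le {L W M D n : ℕ} (hL : 1 ≤ L) (hW : 1 ≤ W) (hM : 1 ≤ M) {β lam : ℝ}
    (hβ : 1 ≤ β) (hlam : 1 ≤ lam) (hlam' : Real.log (4 * M * β) ≤ lam)
    (hD : D ≤ L * (W + 1) ^ 2) (hn1 : 1 ≤ n)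
    (hn : (n : ℝ) ≤ 4 * L * ((W : ℝ) + 1) ^ L * β ^ (L + 1) * √M + 1) :
    Real.log (2 * (n : ℝ) ^ D) ≤ 16 * (L * ((W : ℝ) + 1) ^ (3 / 2 : ℝ) * lam) ^ 2 := by
  have hL' : (1 : ℝ) ≤ L := by exact_mod_cast hL
  have hM' : (1 : ℝ) ≤ M := by exact_mod_cast hM
  have hn' : (1 : ℝ) ≤ n := by exact_mod_cast hn1
  set w : ℝ := (W : ℝ) + 1 with hw
  have hw2 : 2 ≤ w := by
    have : (1 : ℝ) ≤ W := by exact_mod_cast hW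
    linarith
  have hw0 : 0 < w := by linarith
  have hβ0 : 0 < β := by linarith
  have hw3 : (w ^ (3 / 2 : ℝ)) ^ 2 = w ^ 3 := by
    rw [← Real.rpow_natCast, ← Real.rpow_mul hw0.le, ← Real.rpow_natCast]; norm_num
  have hprod : 1 ≤ (L : ℝ) * w ^ L * β ^ (L + 1) := by
    have h1 : 1 ≤ w ^ L := one_le_pow₀ (by linarith)
    have h2 : 1 ≤ β ^ (L + 1) := one_le_pow₀ hβ
    exact one_le_mul_of_one_le_of_one_le (one_le_mul_of_one_le_of_one_le hL' h1) h2
  have hnle : (n : ℝ) ≤ 8 * (L * w ^ L * β ^ (L + 1)) * M := by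
    have h1 : √(M : ℝ) ≤ M := Real.sqrt_le_iff.2 ⟨by linarith, by nlinarith⟩
    have h2 : (L : ℝ) * w ^ L * β ^ (L + 1) * √M ≤ L * w ^ L * β ^ (L + 1) * M :=
      mul_le_mul_of_nonneg_left h1 (by linarith)
    have h3 : 1 ≤ (L : ℝ) * w ^ L * β ^ (L + 1) * M := one_le_mul_of_one_le_of_one_le hprod hM'
    linarith
  have hlogn : Real.log n ≤ 5 / 2 + L + L * w + 3 * L * lam := by
    have h1 : Real.log n ≤ Real.log (8 * (L * w ^ L * β ^ (L + 1)) * M) :=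
      Real.log_le_log (by linarith) hnle
    rw [Real.log_mul (by positivity) (by positivity), Real.log_mul (by positivity) (by positivity),
      Real.log_mul (by positivity) (by positivity), Real.log_mul (by positivity) (by positivity),
      Real.log_pow, Real.log_pow] at h1
    rw [Real.log_mul (by positivity) (by positivity), Real.log_mul (by positivity) (by positivity)]
      at hlam'
    have h8 : Real.log 8 ≤ 5 / 2 := by
      rw [show (8 : ℝ) = 2 ^ 3 by norm_num, Real.log_pow]
      have := Real.log_two_lt_d9
      push_cast; linarith
    have h4 : 0 ≤ Real.log 4 := Real.log_nonneg (by norm_num)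
    have hlL : Real.log L ≤ L := (Real.log_le_sub_one_of_pos (by linarith)).trans (by linarith)
    have hlw : Real.log w ≤ w := (Real.log_le_sub_one_of_pos (by linarith)).trans (by linarith)
    have hlM : 0 ≤ Real.log M := Real.log_nonneg hM'
    have hlβ : 0 ≤ Real.log β := Real.log_nonneg hβ
    have e1 : (L : ℝ) * Real.log w ≤ L * w := mul_le_mul_of_nonneg_left hlw (by linarith)
    have e2 : (((L + 1 : ℕ) : ℝ)) * Real.log β ≤ 2 * L * lam := by
      push_cast
      exact mul_le_mul (by linarith) (by linarith) hlβ (by linarith)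
    have e3 : Real.log M ≤ L * lam := by nlinarith
    linarith
  have hDle : (D : ℝ) ≤ L * w ^ 2 := by
    rw [hw]; exact_mod_cast hD
  have hlogn0 : 0 ≤ Real.log n := Real.log_nonneg hn'
  have hbig : (5 / 2 : ℝ) + L + L * w + 3 * L * lam ≤ 8 * (L * w * lam) := by
    have k1 : (L : ℝ) ≤ L * lam := le_mul_of_one_le_right (by linarith) hlam
    have k2 : (L : ℝ) * lam * 2 ≤ L * lam * w := mul_le_mul_of_nonneg_left hw2 (by positivity)
    have k3 : (L : ℝ) * w ≤ L * w * lam := le_mul_of_one_le_right (by positivity) hlam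
    nlinarith
  rw [Real.log_mul (by norm_num) (by positivity), Real.log_pow]
  have hl2 : Real.log 2 ≤ 1 := by have := Real.log_two_lt_d9; linarith
  calc Real.log 2 + D * Real.log n ≤ 1 + L * w ^ 2 * (8 * (L * w * lam)) := by
        gcongr
        exact hlogn.trans hbig
    _ = 1 + 8 * ((L : ℝ) ^ 2 * w ^ 3 * lam) := by ring
    _ ≤ 16 * ((L : ℝ) ^ 2 * w ^ 3 * (lam * lam)) := by
        have k1 : 1 ≤ (L : ℝ) ^ 2 * w ^ 3 := one_le_mul_of_one_le_of_one_le (one_le_pow₀ hL')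
          (one_le_pow₀ (by linarith))
        have k2 : lam ≤ lam * lam := le_mul_of_one_le_right (by linarith) hlam
        have k3 := mul_le_mul_of_nonneg_left k2 (by linarith : 0 ≤ (L : ℝ) ^ 2 * w ^ 3)
        have k4 := one_le_mul_of_one_le_of_one_le k1 hlam
        linarith
    _ = _ := by rw [mul_pow, mul_pow, hw3]; ring

/-- The generalization error is bounded, uniformly over all parameters in `[-β, β]`, by a random
variable with small `p`-th moment: the maximum over a finite grid of parameters of the deviation of
the empirical risk, plus the discretization error. -/
theorem exists_generalization_bound {Ω : Type*} [MeasurableSpace Ω] {P : Measure Ω}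
    [IsProbabilityMeasure P] {d dp L M W : ℕ} (hL : 1 ≤ L) (hM : 1 ≤ M) (hW1 : 1 ≤ W)
    {p a b u v c β : ℝ} (hp : 1 ≤ p) (huv : u < v) (hc : 1 ≤ c) (hβ : c ≤ β)
    (ha : |a| ≤ β) (hb : |b| ≤ β) {l : ℕ → ℕ} (hl0 : l 0 = d) (hlL : l L = 1)
    (hW : ∀ k ≤ L, l k ≤ W) (hparam : paramCount l L ≤ dp)
    {X : ℕ → Ω → Fin d → ℝ} {Y : ℕ → Ω → ℝ}
    (hXmeas : ∀ j ∈ Set.Icc 1 M, Measurable (X j)) (hYmeas : ∀ j ∈ Set.Icc 1 M, Measurable (Y j))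
    (hX : ∀ j ∈ Set.Icc 1 M, ∀ ω, X j ω ∈ cube d a b)
    (hY : ∀ j ∈ Set.Icc 1 M, ∀ ω, Y j ω ∈ Set.Icc u v)
    (hindep : iIndepFun (fun (j : Set.Icc 1 M) ω => (X j ω, Y j ω)) P)
    (hident : ∀ j ∈ Set.Icc 1 M,
      IdentDistrib (fun ω => (X j ω, Y j ω)) (fun ω => (X 1 ω, Y 1 ω)) P P) :
    ∃ S : Ω → ℝ, Measurable S ∧ (∀ ω, 0 ≤ S ω) ∧
      (∀ ω, ∀ θ : Fin dp → ℝ, (∀ i, |θ i| ≤ β) →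
        |empiricalRisk M (fun j => X j ω) (fun j => Y j ω) (scalarNetwork l L hl0 hlL u v θ)
          - ∫ ω', |scalarNetwork l L hl0 hlL u v θ (X 1 ω') - Y 1 ω'| ^ 2 ∂P| ≤ S ω) ∧
      (∫⁻ ω, ENNReal.ofReal (S ω) ^ p ∂P) ^ (1 / p) ≤ ENNReal.ofReal
        (5 * (max (v - u) 1) ^ 2 * L * ((W : ℝ) + 1) ^ (3 / 2 : ℝ)
          * max p (Real.log (4 * M * β * c)) / √(M : ℝ)) := by
  have hp0 : 0 < p := by linarith
  have h1M : 1 ∈ Set.Icc 1 M := ⟨le_rfl, hM⟩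
  have hM0 : (0 : ℝ) < M := by exact_mod_cast hM
  have hM1 : (1 : ℝ) ≤ M := by exact_mod_cast hM
  have hL1 : (1 : ℝ) ≤ L := by exact_mod_cast hL
  have hβ1 : 1 ≤ β := hc.trans hβ
  have hβ0 : 0 < β := by linarith
  have huv0 : 0 < v - u := by linarith
  set D := paramCount l L with hD
  set w : ℝ := (W : ℝ) + 1 with hw
  have hw1 : 1 ≤ w := by simp [hw]
  set lam := max p (Real.log (4 * M * β * c)) with hlam
  have hlam1 : 1 ≤ lam := hp.trans (le_max_left _ _)
  set n := ⌈4 * L * w ^ L * β ^ (L + 1) * √(M : ℝ)⌉₊ with hn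
  have hsM : 0 < √(M : ℝ) := Real.sqrt_pos.2 hM0
  have hnpos : 0 < 4 * L * w ^ L * β ^ (L + 1) * √(M : ℝ) := by positivity
  have hn1 : 1 ≤ n := Nat.one_le_ceil_iff.2 hnpos
  have hn0 : (0 : ℝ) < n := by exact_mod_cast hn1
  have hnup : (n : ℝ) ≤ 4 * L * w ^ L * β ^ (L + 1) * √(M : ℝ) + 1 :=
    (Nat.ceil_lt_add_one hnpos.le).le
  have hnlow : 4 * L * w ^ L * β ^ (L + 1) * √(M : ℝ) ≤ n := Nat.le_ceil _
  have : Nonempty (Fin D → Fin n) := ⟨fun _ => ⟨0, hn1⟩⟩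
  let f : (Fin dp → ℝ) → (Fin d → ℝ) → ℝ := fun θ => scalarNetwork l L hl0 hlL u v θ
  have hfm : ∀ θ, Measurable (f θ) := fun θ =>
    (measurable_scalarNetwork l L hl0 hlL u v).comp measurable_prodMk_left
  have hfuv : ∀ θ x, f θ x ∈ Set.Icc u v := fun θ x =>
    scalarNetwork_mem_Icc hL hl0 hlL huv.le θ x
  let R : (Fin dp → ℝ) → Ω → ℝ := fun θ ω =>
    empiricalRisk M (fun j => X j ω) (fun j => Y j ω) (f θ)
  let r : (Fin dp → ℝ) → ℝ := fun θ => ∫ ω', |f θ (X 1 ω') - Y 1 ω'| ^ 2 ∂P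
  let Z : (Fin D → Fin n) → Ω → ℝ := fun g ω => R (gridParam dp β g) ω - r (gridParam dp β g)
  have hZm : ∀ g, Measurable (Z g) := by
    intro g
    refine Measurable.sub_const (Measurable.const_mul (Finset.measurable_sum _ fun j hj => ?_) _) _
    have hj' : j ∈ Set.Icc 1 M := by simpa using hj
    exact (((hfm _).comp (hXmeas j hj')).sub (hYmeas j hj')).abs.pow_const 2
  let S₀ : Ω → ℝ := fun ω => Finset.univ.sup' Finset.univ_nonempty fun g => |Z g ω|
  have hS₀m : Measurable S₀ := by
    simp only [S₀, Finset.sup'_univ_eq_ciSup]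
    exact Measurable.iSup fun g => (hZm g).abs
  have hS₀ : ∀ g ω, |Z g ω| ≤ S₀ ω := fun g ω =>
    Finset.le_sup' (fun g => |Z g ω|) (Finset.mem_univ g)
  set disc := (v - u) / √(M : ℝ) with hdisc
  have hdisc0 : 0 ≤ disc := by positivity
  have hS0 : ∀ ω, 0 ≤ S₀ ω := fun ω =>
    (abs_nonneg _).trans (hS₀ (Classical.arbitrary _) ω)
  refine ⟨fun ω => S₀ ω + disc, hS₀m.add_const _, fun ω => add_nonneg (hS0 ω) hdisc0, ?_, ?_⟩
  · intro ω θ hθ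
    obtain ⟨g, hg⟩ := exists_gridParam_near hparam hn1 hβ0 hθ
    set θ' := gridParam dp β g
    have hθ' := abs_gridParam_le (dp := dp) hβ0.le g
    set η := L * w ^ L * β ^ L * (β / n) with hη
    have hclose : ∀ x ∈ cube d a b, |f θ x - f θ' x| ≤ η := fun x hx =>
      abs_scalarNetwork_sub_le hl0 hlL hW hβ1 (abs_param_le hβ0.le hθ) (abs_param_le hβ0.le hθ')
        (by positivity) hg fun j =>
          (abs_le_max_abs_abs (hx.1 j) (hx.2 j)).trans (max_le ha hb)
    have h1 : |R θ ω - R θ' ω| ≤ 2 * (v - u) * η :=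
      abs_empiricalRisk_sub_le hM huv.le (fun j hj => hY j hj ω) (hfuv θ) (hfuv θ')
        fun j hj => hclose _ (hX j hj ω)
    have h2 : |r θ - r θ'| ≤ 2 * (v - u) * η :=
      abs_integral_sq_loss_sub_le huv.le (hXmeas 1 h1M) (hYmeas 1 h1M) (hY 1 h1M) (hfm θ) (hfm θ')
        (hfuv θ) (hfuv θ') fun ω' => hclose _ (hX 1 h1M ω')
    have h3 : |R θ' ω - r θ'| ≤ S₀ ω := hS₀ g ω
    have h4 : 4 * (v - u) * η ≤ disc := by
      have : 4 * η ≤ 1 / √(M : ℝ) := by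
        rw [hη, le_div_iff₀ hsM]
        calc 4 * (L * w ^ L * β ^ L * (β / n)) * √(M : ℝ)
            = (4 * L * w ^ L * β ^ (L + 1) * √(M : ℝ)) / n := by rw [pow_succ]; ring
          _ ≤ 1 := (div_le_one hn0).2 hnlow
      calc 4 * (v - u) * η = (v - u) * (4 * η) := by ring
        _ ≤ (v - u) * (1 / √(M : ℝ)) := by gcongr
        _ = disc := by rw [hdisc]; ring
    change |R θ ω - r θ| ≤ S₀ ω + disc
    have h1' := abs_le.1 h1
    have h2' := abs_le.1 h2
    have h3' := abs_le.1 h3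
    rw [abs_le]; constructor <;> linarith
  · set q := max p (Real.log (2 * Fintype.card (Fin D → Fin n))) with hq
    set V := (v - u) ^ 2 with hV
    have hV0 : 0 < V := by positivity
    have hsub := lintegral_sup_abs_rpow_le (P := P) (Z := Z)
      (v := Real.toNNReal (V ^ 2 / (4 * M))) (Real.toNNReal_pos.2 (by positivity))
      (fun g => hasSubgaussianMGF_empiricalRisk_sub hM hXmeas hYmeas hY hindep hident
        (hfm _) (hfuv _)) hZm hp0 (le_max_left _ _) (le_max_right p _)
    rw [← hq, Real.coe_toNNReal _ (by positivity)] at hsub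
    set T := L * w ^ (3 / 2 : ℝ) * lam with hT
    have hw32 : 1 ≤ w ^ (3 / 2 : ℝ) := Real.one_le_rpow hw1 (by norm_num)
    have hT1 : 1 ≤ T :=
      one_le_mul_of_one_le_of_one_le (one_le_mul_of_one_le_of_one_le hL1 hw32) hlam1
    have hlamT : lam ≤ T := le_mul_of_one_le_left (by linarith)
      (one_le_mul_of_one_le_of_one_le hL1 hw32)
    have hqT : q ≤ 16 * T ^ 2 := by
      refine max_le ?_ ?_
      · have := le_max_left p (Real.log (4 * M * β * c))
        nlinarith
      · have hlog : Real.log (4 * M * β) ≤ lam := by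
          refine le_trans (Real.log_le_log (by positivity) ?_) (le_max_right _ _)
          exact le_mul_of_one_le_right (by positivity) hc
        have := log_two_mul_pow_le hL hW1 hM hβ1 hlam1 hlog (paramCount_le hW) hn1 hnup
        simpa [← hD] using this
    set V' := (max (v - u) 1) ^ 2 with hV'
    have hVV' : V ≤ V' := pow_le_pow_left₀ huv0.le (le_max_left _ _) 2
    have huvV' : v - u ≤ V' := by
      have h1 := le_max_left (v - u) 1
      have h2 := le_max_right (v - u) 1
      rw [hV']; nlinarith
    have hsqrt : √(q * (V ^ 2 / (4 * M)) * Real.exp 1) ≤ 4 * T * V / √(M : ℝ) := by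
      refine Real.sqrt_le_iff.2 ⟨by positivity, ?_⟩
      have he : Real.exp 1 ≤ 4 := by have := Real.exp_one_lt_d9; linarith
      rw [div_pow, Real.sq_sqrt hM0.le]
      calc q * (V ^ 2 / (4 * M)) * Real.exp 1 ≤ 16 * T ^ 2 * (V ^ 2 / (4 * M)) * 4 := by gcongr
        _ = (4 * T * V) ^ 2 / M := by field_simp; ring
    have hadd := ENNReal.lintegral_Lp_add_le (μ := P) (p := p)
      (f := fun ω => ENNReal.ofReal (S₀ ω)) (g := fun _ => ENNReal.ofReal disc)
      hS₀m.ennreal_ofReal.aemeasurable aemeasurable_const hp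
    have hconst : (∫⁻ _ω, ENNReal.ofReal disc ^ p ∂P) ^ (1 / p) = ENNReal.ofReal disc := by
      rw [lintegral_const, measure_univ, mul_one, ← ENNReal.rpow_mul, mul_one_div_cancel hp0.ne',
        ENNReal.rpow_one]
    rw [hconst] at hadd
    simp only [Pi.add_apply, ← ENNReal.ofReal_add (hS0 _) hdisc0] at hadd
    refine hadd.trans ((add_le_add_left hsub _).trans ?_)
    rw [← ENNReal.ofReal_add (Real.sqrt_nonneg _) hdisc0]
    refine ENNReal.ofReal_le_ofReal ?_
    calc √(q * (V ^ 2 / (4 * M)) * Real.exp 1) + disc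
        ≤ 4 * T * V / √(M : ℝ) + V' * T / √(M : ℝ) := by
          refine add_le_add hsqrt (div_le_div_of_nonneg_right ?_ hsM.le)
          exact huvV'.trans (le_mul_of_one_le_right (by positivity) hT1)
      _ ≤ 4 * T * V' / √(M : ℝ) + V' * T / √(M : ℝ) := by gcongr
      _ = _ := by rw [hT]; ring

/-! ### The regression function and the decomposition of the risk -/

/-- The componentwise projection onto the cube `[a, b]^d`. -/
def cubeProj {d : ℕ} (a b : ℝ) (x : Fin d → ℝ) : Fin d → ℝ := fun i => max a (min (x i) b)

lemma continuous_cubeProj {d : ℕ} (a b : ℝ) : Continuous (cubeProj a b : (Fin d → ℝ) → _) := by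
  unfold cubeProj; fun_prop

lemma cubeProj_mem {d : ℕ} {a b : ℝ} (hab : a ≤ b) (x : Fin d → ℝ) : cubeProj a b x ∈ cube d a b :=
  ⟨fun _ => le_max_left _ _, fun _ => max_le hab (min_le_right _ _)⟩

lemma cubeProj_eq_self {d : ℕ} {a b : ℝ} {x : Fin d → ℝ} (hx : x ∈ cube d a b) :
    cubeProj a b x = x := by
  funext i
  rw [cubeProj, min_eq_left (hx.2 i), max_eq_right (hx.1 i)]

lemma continuousOn_of_abs_sub_le {d : ℕ} {s : Set (Fin d → ℝ)} {E : (Fin d → ℝ) → ℝ} {K : ℝ}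
    (hK : 0 ≤ K) (hE : ∀ x ∈ s, ∀ y ∈ s, |E x - E y| ≤ K * ∑ i, |x i - y i|) :
    ContinuousOn E s := by
  have h : LipschitzOnWith (Real.toNNReal (K * d)) E s := by
    refine LipschitzOnWith.of_dist_le_mul fun x hx y hy => ?_
    rw [Real.coe_toNNReal _ (by positivity), Real.dist_eq, mul_assoc]
    refine (hE x hx y hy).trans (mul_le_mul_of_nonneg_left ?_ hK)
    refine (Finset.sum_le_card_nsmul _ _ (dist x y) fun i _ => ?_).trans (by simp)
    rw [← Real.dist_eq]
    exact dist_le_pi_dist x y i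
  exact h.continuousOn

/-- Bias-variance decomposition: the excess risk of `f` over the regression function `E` is the
mean squared distance of `f` and `E`. -/
lemma integral_sq_loss_eq_add {Ω : Type*} [MeasurableSpace Ω] {P : Measure Ω}
    [IsProbabilityMeasure P] {d : ℕ} {u v : ℝ} {X : Ω → Fin d → ℝ} {Y : Ω → ℝ} (hX : Measurable X)
    (hYm : Measurable Y) (hY : ∀ ω, Y ω ∈ Set.Icc u v) {f E : (Fin d → ℝ) → ℝ}
    (hfm : Measurable f) (hEm : Measurable E) (hf : ∀ x, f x ∈ Set.Icc u v)
    (hE : ∀ x, E x ∈ Set.Icc u v)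
    (hcond : (fun ω => E (X ω)) =ᵐ[P] P[Y | MeasurableSpace.comap X inferInstance]) :
    ∫ ω, |f (X ω) - Y ω| ^ 2 ∂P
      = (∫ ω, |f (X ω) - E (X ω)| ^ 2 ∂P) + ∫ ω, |E (X ω) - Y ω| ^ 2 ∂P := by
  let g : Ω → ℝ := fun ω => f (X ω) - E (X ω)
  have hgX : Measurable g := (hfm.comp hX).sub (hEm.comp hX)
  have hgm : StronglyMeasurable[MeasurableSpace.comap X inferInstance] g :=
    (((hfm.sub hEm).comp (comap_measurable X))).stronglyMeasurable
  have hYi : Integrable Y P := Integrable.of_mem_Icc u v hYm.aemeasurable (.of_forall hY)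
  have hEi : Integrable (fun ω => E (X ω)) P :=
    Integrable.of_mem_Icc u v (hEm.comp hX).aemeasurable (.of_forall fun ω => hE _)
  have hgb : ∀ ω, ‖g ω‖ ≤ v - u := fun ω => by
    have h1 := hf (X ω)
    have h2 := hE (X ω)
    rw [Real.norm_eq_abs, abs_le]
    constructor <;> simp only [g] <;> linarith [h1.1, h1.2, h2.1, h2.2]
  have hgY : Integrable (g * Y) P := hYi.bdd_mul hgX.aestronglyMeasurable (.of_forall hgb)
  have hgE : Integrable (g * fun ω => E (X ω)) P :=
    hEi.bdd_mul hgX.aestronglyMeasurable (.of_forall hgb)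
  have hortho : ∫ ω, (g * Y) ω ∂P = ∫ ω, (g * fun ω => E (X ω)) ω ∂P := by
    rw [← integral_condExp hX.comap_le (f := g * Y)]
    refine integral_congr_ae ?_
    filter_upwards [condExp_mul_of_stronglyMeasurable_left hgm hgY hYi, hcond] with ω h1 h2
    rw [h1, Pi.mul_apply, Pi.mul_apply, ← h2]
  have hpt : ∀ ω, |f (X ω) - Y ω| ^ 2 = (|f (X ω) - E (X ω)| ^ 2 + |E (X ω) - Y ω| ^ 2)
      + 2 * ((g * fun ω => E (X ω)) ω - (g * Y) ω) := by
    intro ω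
    simp only [sq_abs, Pi.mul_apply, g]; ring
  have hi1 : Integrable (fun ω => |f (X ω) - E (X ω)| ^ 2) P :=
    integrable_sq_loss hX (hEm.comp hX) (fun ω => hE _) hfm hf
  have hi2 := integrable_sq_loss (P := P) hX hYm hY hEm hE
  have hi12 : Integrable (fun ω => |f (X ω) - E (X ω)| ^ 2 + |E (X ω) - Y ω| ^ 2) P := hi1.add hi2
  have hi3 : Integrable (fun ω => 2 * ((g * fun ω => E (X ω)) ω - (g * Y) ω)) P :=
    (hgE.sub hgY).const_mul 2
  simp_rw [hpt]
  rw [integral_add hi12 hi3, integral_add hi1 hi2,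
    integral_const_mul, integral_sub hgE hgY, hortho, sub_self, mul_zero, add_zero]

lemma setLIntegral_map_eq_ofReal_integral {Ω : Type*} [MeasurableSpace Ω] {P : Measure Ω}
    [IsProbabilityMeasure P] {d : ℕ} {a b u v : ℝ} {X : Ω → Fin d → ℝ} (hX : Measurable X)
    (hXc : ∀ ω, X ω ∈ cube d a b) {f E : (Fin d → ℝ) → ℝ} (hfm : Measurable f) (hEm : Measurable E)
    (hf : ∀ x, f x ∈ Set.Icc u v) (hE : ∀ x, E x ∈ Set.Icc u v) :
    ∫⁻ x in cube d a b, ENNReal.ofReal (|f x - E x| ^ 2) ∂(P.map X)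
      = ENNReal.ofReal (∫ ω, |f (X ω) - E (X ω)| ^ 2 ∂P) := by
  have hcube : MeasurableSet (cube d a b) := measurableSet_Icc
  have hmem : ∀ᵐ x ∂(P.map X), x ∈ cube d a b :=
    (ae_map_iff (p := fun x => x ∈ cube d a b) hX.aemeasurable hcube).2 (.of_forall hXc)
  have hloss : Measurable fun x => ENNReal.ofReal (|f x - E x| ^ 2) :=
    ((hfm.sub hEm).abs.pow_const 2).ennreal_ofReal
  rw [Measure.restrict_eq_self_of_ae_mem hmem, lintegral_map hloss hX]
  exact (ofReal_integral_eq_lintegral_ofReal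
    (integrable_sq_loss hX (hEm.comp hX) (fun ω => hE (X ω)) hfm hf)
    (.of_forall fun ω => by positivity)).symm

lemma measurable_apply_index {Ω α : Type*} [MeasurableSpace Ω] [MeasurableSpace α]
    {Θ : ℕ → ℕ → Ω → α} (hΘ : ∀ k n, Measurable (Θ k n)) {κ : Ω → ℕ × ℕ} (hκ : Measurable κ) :
    Measurable fun ω => Θ (κ ω).1 (κ ω).2 ω := by
  have h : Measurable fun q : (ℕ × ℕ) × Ω => Θ q.1.1 q.1.2 q.2 :=
    measurable_from_prod_countable_right fun q => hΘ q.1 q.2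
  exact h.comp (hκ.prodMk measurable_id)

lemma ae_mem_cube_of_isUniform {Ω : Type*} [MeasurableSpace Ω] {P : Measure Ω}
    [IsProbabilityMeasure P] {dp : ℕ} {c : ℝ} {Z : Ω → Fin dp → ℝ} (hZ : Measurable Z)
    (h : pdf.IsUniform Z (cube dp (-c) c) P volume) : ∀ᵐ ω ∂P, Z ω ∈ cube dp (-c) c := by
  have hcube : MeasurableSet (cube dp (-c) c) := measurableSet_Icc
  rw [← ae_map_iff (p := fun θ => θ ∈ cube dp (-c) c) hZ.aemeasurable hcube, h]
  exact ae_cond_mem hcube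

/-- The training error decomposition: the error of the selected network is at most the error of a
reference network, plus the optimization error, plus twice the generalization error. -/
lemma error_le_of_argMin {α : Type*} {e R : α → ℝ} {σ s η : ℝ} {θ θ₀ : α}
    (hθ : |R θ - (e θ + σ)| ≤ s) (hθ₀ : |R θ₀ - (e θ₀ + σ)| ≤ s) (hR : R θ ≤ R θ₀)
    (hη : e θ₀ ≤ η) : e θ ≤ η + 2 * s := by
  have h1 := abs_le.1 hθ
  have h2 := abs_le.1 hθ₀
  linarith [h1.1, h2.2]

end ClippedDNN

/-! ### The overall error -/

theorem mainTheorem2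
    -- dimensions, sample size, numbers of initializations and of optimization steps
    (d dp L M K N : ℕ) (hd : 1 ≤ d) (hdp : 1 ≤ dp) (hL : 1 ≤ L) (hM : 1 ≤ M) (hK : 1 ≤ K)
    (hN : 1 ≤ N)
    (A p Lip a b u v c β : ℝ) (hA : 0 < A) (hp : 0 < p) (hLip : 0 ≤ Lip) (hab : a < b)
    (huv : u < v)
    (hc : max 1 (max (2 * |u|) (max (2 * |v|) (max |a| (max |b| Lip)))) ≤ c) (hβ : c ≤ β)
    -- the architecture
    (l : ℕ → ℕ) (hlpos : ∀ i ≤ L, 1 ≤ l i) (hl0 : l 0 = d) (hlL : l L = 1)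
    (hdepth : 1 + ((⌈Real.logb 2 (A / (2 * d))⌉ : ℝ) + 1) *
      (Set.Ioi ((6 : ℝ) ^ d)).indicator 1 A ≤ (L : ℝ))
    (hl1 : A * (Set.Ioi ((6 : ℝ) ^ d)).indicator 1 A ≤ (l 1 : ℝ))
    (hli : ∀ i, 2 ≤ i → i < L →
      3 * (⌈A / (2 ^ i * d)⌉ : ℝ) * (Set.Ioi ((6 : ℝ) ^ d)).indicator 1 A ≤ (l i : ℝ))
    (hparam : ∑ i ∈ Finset.Icc 1 L, l i * (l (i - 1) + 1) ≤ dp)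
    (steps : Set ℕ) (hsteps : steps ⊆ Set.Iic N) (h0steps : 0 ∈ steps)
    {Ω : Type*} [MeasurableSpace Ω] (P : Measure Ω) [IsProbabilityMeasure P]
    -- the data
    (X : ℕ → Ω → Fin d → ℝ) (Y : ℕ → Ω → ℝ)
    (hXmeas : ∀ j ∈ Set.Icc 1 M, Measurable (X j))
    (hYmeas : ∀ j ∈ Set.Icc 1 M, Measurable (Y j))
    (hX : ∀ j ∈ Set.Icc 1 M, ∀ ω, X j ω ∈ ClippedDNN.cube d a b)
    (hY : ∀ j ∈ Set.Icc 1 M, ∀ ω, Y j ω ∈ Set.Icc u v)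
    (hindep : iIndepFun (fun (j : Set.Icc 1 M) ω => (X j ω, Y j ω)) P)
    (hident : ∀ j ∈ Set.Icc 1 M,
      IdentDistrib (fun ω => (X j ω, Y j ω)) (fun ω => (X 1 ω, Y 1 ω)) P P)
    -- the regression function, of which only the values on the cube matter
    (E : (Fin d → ℝ) → ℝ) (hE : ∀ x ∈ ClippedDNN.cube d a b, E x ∈ Set.Icc u v)
    (hEcond : (fun ω => E (X 1 ω)) =ᵐ[P] P[Y 1 | MeasurableSpace.comap (X 1) inferInstance])
    (hELip : ∀ x ∈ ClippedDNN.cube d a b, ∀ y ∈ ClippedDNN.cube d a b,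
      |E x - E y| ≤ Lip * ∑ i, |x i - y i|)
    -- the parameter vectors produced by the optimization algorithm
    (Θ : ℕ → ℕ → Ω → Fin dp → ℝ) (hΘmeas : ∀ k n, Measurable (Θ k n))
    (hΘindep : iIndepFun (fun (k : Set.Icc 1 K) => Θ k 0) P)
    (hΘident : ∀ k ∈ Set.Icc 1 K, IdentDistrib (Θ k 0) (Θ 1 0) P P)
    (hΘunif : pdf.IsUniform (Θ 1 0) (ClippedDNN.cube dp (-c) c) P volume)
    -- the selected index; `‖·‖` is the maximum norm on `Fin dp → ℝ`
    (κ : Ω → ℕ × ℕ) (hκmeas : Measurable κ)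
    (hκ : ∀ ω, κ ω ∈ ClippedDNN.argMin
      (fun q : ℕ × ℕ => ClippedDNN.empiricalRisk M (fun j => X j ω) (fun j => Y j ω)
        (ClippedDNN.scalarNetwork l L hl0 hlL u v (Θ q.1 q.2 ω)))
      {q : ℕ × ℕ | q.1 ∈ Set.Icc 1 K ∧ q.2 ∈ steps ∧ ‖Θ q.1 q.2 ω‖ ≤ β}) :
    Measurable (fun ω => ∫⁻ x in ClippedDNN.cube d a b,
        ENNReal.ofReal (|ClippedDNN.scalarNetwork l L hl0 hlL u v
          (Θ (κ ω).1 (κ ω).2 ω) x - E x| ^ 2) ∂(P.map (X 1))) ∧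
    (∫⁻ ω, (∫⁻ x in ClippedDNN.cube d a b,
        ENNReal.ofReal (|ClippedDNN.scalarNetwork l L hl0 hlL u v
          (Θ (κ ω).1 (κ ω).2 ω) x - E x| ^ 2) ∂(P.map (X 1))) ^ p ∂P) ^ (1 / p)
      ≤ ENNReal.ofReal
        (9 * (d : ℝ) ^ 2 * Lip ^ 2 * (b - a) ^ 2 / A ^ (2 / (d : ℝ))
        + 4 * (v - u) * L * ((ClippedDNN.maxWidth l L : ℝ) + 1) ^ L * c ^ (L + 1) * max p 1
            / (K : ℝ) ^ ((L : ℝ)⁻¹ * (((ClippedDNN.maxWidth l L : ℝ) + 1) ^ 2)⁻¹)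
        + 10 * (max (v - u) 1) ^ 2 * L * ((ClippedDNN.maxWidth l L : ℝ) + 1) ^ (3 / 2 : ℝ)
            * max p (Real.log (4 * M * β * c)) / √(M : ℝ)) := by
  have hp0' : 0 < max p 1 := lt_max_of_lt_left hp
  have hc' := hc
  simp only [max_le_iff] at hc'
  obtain ⟨hc1, -, -, hca, hcb, -⟩ := hc'
  have hc0 : 0 < c := by linarith
  have hβ1 : 1 ≤ β := hc1.trans hβ
  have h1M : 1 ∈ Set.Icc 1 M := ⟨le_rfl, hM⟩
  have h1K : 1 ∈ Set.Icc 1 K := ⟨le_rfl, hK⟩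
  have huv0 : 0 < v - u := by linarith
  have hM1 : (1 : ℝ) ≤ M := by exact_mod_cast hM
  have hK1 : (1 : ℝ) ≤ K := by exact_mod_cast hK
  rw [← ClippedDNN.paramCount_eq] at hparam
  set W := ClippedDNN.maxWidth l L with hWdef
  have hW : ∀ k ≤ L, l k ≤ W := fun k hk =>
    Finset.le_sup (f := l) (Finset.mem_range.2 (Nat.lt_succ_of_le hk))
  have hW1 : 1 ≤ W := (hlpos 0 (Nat.zero_le L)).trans (hW 0 (Nat.zero_le L))
  set D := ClippedDNN.paramCount l L with hD
  have hD1 : 1 ≤ D := by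
    have h1 := ClippedDNN.paramCount_mono l hL
    rw [ClippedDNN.paramCount_succ] at h1
    have h2 : 1 ≤ l (0 + 1) * (l 0 + 1) := Nat.mul_pos (hlpos 1 hL) (Nat.succ_pos _)
    omega
  set f : (Fin dp → ℝ) → (Fin d → ℝ) → ℝ := fun θ =>
    ClippedDNN.scalarNetwork l L hl0 hlL u v θ with hf
  have hfm : ∀ θ, Measurable (f θ) := fun θ =>
    (ClippedDNN.measurable_scalarNetwork l L hl0 hlL u v).comp measurable_prodMk_left
  have hfuv : ∀ θ x, f θ x ∈ Set.Icc u v := fun θ x =>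
    ClippedDNN.scalarNetwork_mem_Icc hL hl0 hlL huv.le θ x
  -- outside of the cube, where nothing is known about `E`, replace it by a continuous function
  set E' : (Fin d → ℝ) → ℝ := fun x => E (ClippedDNN.cubeProj a b x) with hE'
  have hE'm : Measurable E' :=
    ((ClippedDNN.continuousOn_of_abs_sub_le hLip hELip).comp_continuous
      (ClippedDNN.continuous_cubeProj a b) (ClippedDNN.cubeProj_mem hab.le)).measurable
  have hE'uv : ∀ x, E' x ∈ Set.Icc u v := fun x => hE _ (ClippedDNN.cubeProj_mem hab.le x)
  have hEE' : ∀ x ∈ ClippedDNN.cube d a b, E x = E' x := fun x hx => by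
    rw [hE']; simp only [ClippedDNN.cubeProj_eq_self hx]
  have hX1 := hXmeas 1 h1M
  have hX1c := hX 1 h1M
  have hcond' : (fun ω => E' (X 1 ω))
      =ᵐ[P] P[Y 1 | MeasurableSpace.comap (X 1) inferInstance] := by
    have : (fun ω => E' (X 1 ω)) = fun ω => E (X 1 ω) :=
      funext fun ω => (hEE' _ (hX1c ω)).symm
    rw [this]; exact hEcond
  have hcube : MeasurableSet (ClippedDNN.cube d a b) := measurableSet_Icc
  have hswap : ∀ θ, ∫⁻ x in ClippedDNN.cube d a b, ENNReal.ofReal (|f θ x - E x| ^ 2) ∂(P.map (X 1))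
      = ∫⁻ x in ClippedDNN.cube d a b, ENNReal.ofReal (|f θ x - E' x| ^ 2) ∂(P.map (X 1)) :=
    fun θ => setLIntegral_congr_fun hcube fun x hx => by simp only [hEE' x hx]
  have hsel : Measurable fun ω => Θ (κ ω).1 (κ ω).2 ω :=
    ClippedDNN.measurable_apply_index hΘmeas hκmeas
  have : IsProbabilityMeasure (P.map (X 1)) := Measure.isProbabilityMeasure_map hX1.aemeasurable
  have hmeas : Measurable fun ω => ∫⁻ x in ClippedDNN.cube d a b,
      ENNReal.ofReal (|f (Θ (κ ω).1 (κ ω).2 ω) x - E x| ^ 2) ∂(P.map (X 1)) := by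
    simp_rw [hswap]
    have hjoint : Measurable fun q : (Fin dp → ℝ) × (Fin d → ℝ) =>
        ENNReal.ofReal (|f q.1 q.2 - E' q.2| ^ 2) :=
      (((ClippedDNN.measurable_scalarNetwork l L hl0 hlL u v).sub
        (hE'm.comp measurable_snd)).abs.pow_const 2).ennreal_ofReal
    exact (Measurable.lintegral_prod_right' (ν := (P.map (X 1)).restrict (ClippedDNN.cube d a b))
      hjoint).comp hsel
  refine ⟨hmeas, ?_⟩
  -- all terms on the right-hand side are the same for `p` and for `max p 1`
  refine (ClippedDNN.lintegral_rpow_one_div_mono hmeas.aemeasurable hp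
    (le_max_left p 1)).trans ?_
  have hlog1 : 1 ≤ Real.log (4 * M * β * c) := by
    have h4 : (4 : ℝ) ≤ 4 * M * β * c := by
      have : 1 ≤ M * β * c :=
        one_le_mul_of_one_le_of_one_le (one_le_mul_of_one_le_of_one_le hM1 hβ1) hc1
      linarith
    rw [Real.le_log_iff_exp_le (by linarith)]
    have := Real.exp_one_lt_d9
    linarith
  have hmaxlog : max (max p 1) (Real.log (4 * M * β * c)) = max p (Real.log (4 * M * β * c)) := by
    rw [max_assoc, max_eq_right hlog1]
  have hp1 : 1 ≤ max p 1 := le_max_right p 1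
  -- the three sources of error
  obtain ⟨θs, hθs, happrox⟩ := ClippedDNN.exists_scalarNetwork_approx (dp := dp) hd hL hA hLip hab
    hc hl0 hlL hdepth hl1 hli hparam hE hELip
  obtain ⟨S, hSm, hS0, hS, hSp⟩ := ClippedDNN.exists_generalization_bound (P := P) hL hM hW1 hp1 huv
    hc1 hβ (hca.trans hβ) (hcb.trans hβ) hl0 hlL hW hparam hXmeas hYmeas hX hY hindep hident
  rw [hmaxlog] at hSp
  have : Nonempty (Set.Icc 1 K) := ⟨⟨1, h1K⟩⟩
  have hunif : ∀ k : Set.Icc 1 K, pdf.IsUniform (Θ k 0) (ClippedDNN.cube dp (-c) c) P volume :=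
    fun k => (hΘident k k.2).map_eq.trans hΘunif
  have hopt := ClippedDNN.lintegral_inf_paramDist_rpow_le (P := P) hD1 hparam hc0 hp1 hθs
    (fun k : Set.Icc 1 K => hΘmeas k 0) hΘindep hunif
  set m : Ω → ℝ := fun ω => Finset.univ.inf' Finset.univ_nonempty
    fun k : Set.Icc 1 K => ClippedDNN.paramDist D (Θ k 0 ω) θs with hm
  have hm0 : ∀ ω, 0 ≤ m ω := fun ω =>
    Finset.le_inf' _ _ fun k _ => ClippedDNN.paramDist_nonneg _ _ _
  have hmm : Measurable m := by
    simp only [hm, Finset.inf'_univ_eq_ciInf]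
    exact Measurable.iInf fun k => (ClippedDNN.measurable_paramDist D θs).comp (hΘmeas k 0)
  set B := 9 * (d : ℝ) ^ 2 * Lip ^ 2 * (b - a) ^ 2 / A ^ (2 / (d : ℝ)) with hB
  have hB0 : 0 ≤ B := by positivity
  set C := 2 * (v - u) * (L * ((W : ℝ) + 1) ^ L * c ^ L) with hC
  have hC0 : 0 ≤ C := by positivity
  let e : (Fin dp → ℝ) → ℝ := fun θ => ∫ ω, |f θ (X 1 ω) - E' (X 1 ω)| ^ 2 ∂P
  have herr : ∀ θ, ∫⁻ x in ClippedDNN.cube d a b, ENNReal.ofReal (|f θ x - E x| ^ 2) ∂(P.map (X 1))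
      = ENNReal.ofReal (e θ) := fun θ => (hswap θ).trans
    (ClippedDNN.setLIntegral_map_eq_ofReal_integral hX1 hX1c (hfm θ) hE'm (hfuv θ) hE'uv)
  have hes : e θs ≤ B := by
    have h1 : ∀ ω, |f θs (X 1 ω) - E' (X 1 ω)| ^ 2 ≤ B := fun ω => by
      rw [← hEE' _ (hX1c ω)]; exact happrox _ (hX1c ω)
    have h2 := integral_mono (μ := P) (ClippedDNN.integrable_sq_loss hX1 (hE'm.comp hX1)
      (fun ω => hE'uv _) (hfm θs) (hfuv θs)) (integrable_const B) h1
    exact h2.trans_eq (by simp)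
  have hest : ∀ θ : Fin dp → ℝ, (∀ i, |θ i| ≤ c) →
      e θ ≤ B + C * ClippedDNN.paramDist D θ θs := by
    intro θ hθ
    have h1 := ClippedDNN.abs_integral_sq_loss_sub_le (P := P) huv.le hX1 (hE'm.comp hX1)
      (fun ω => hE'uv _) (hfm θ) (hfm θs) (hfuv θ) (hfuv θs)
      (fun ω => ClippedDNN.abs_scalarNetwork_sub_le hl0 hlL hW hc1
        (ClippedDNN.abs_param_le hc0.le hθ) (ClippedDNN.abs_param_le hc0.le hθs)
        (ClippedDNN.paramDist_nonneg D θ θs)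
        ((ClippedDNN.paramDist_le_iff (ClippedDNN.paramDist_nonneg D θ θs)).1 le_rfl)
        fun j => (abs_le_max_abs_abs ((hX1c ω).1 j) ((hX1c ω).2 j)).trans (max_le hca hcb))
    have h2 : e θ - e θs ≤ C * ClippedDNN.paramDist D θ θs :=
      (le_abs_self _).trans (h1.trans_eq (by rw [hC]; ring))
    linarith
  have hpt : ∀ᵐ ω ∂P, e (Θ (κ ω).1 (κ ω).2 ω) ≤ (B + C * m ω) + 2 * S ω := by
    have hae : ∀ᵐ ω ∂P, ∀ k : Set.Icc 1 K, Θ k 0 ω ∈ ClippedDNN.cube dp (-c) c :=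
      ae_all_iff.2 fun k => ClippedDNN.ae_mem_cube_of_isUniform (hΘmeas k 0) (hunif k)
    filter_upwards [hae] with ω hω
    obtain ⟨k, -, hk⟩ := Finset.exists_mem_eq_inf' (s := Finset.univ) Finset.univ_nonempty
      fun k : Set.Icc 1 K => ClippedDNN.paramDist D (Θ k 0 ω) θs
    have hkc : ∀ i, |Θ k 0 ω i| ≤ c := fun i => abs_le.2 ⟨(hω k).1 i, (hω k).2 i⟩
    have hmemk : ((k : ℕ), 0) ∈ {q : ℕ × ℕ | q.1 ∈ Set.Icc 1 K ∧ q.2 ∈ steps ∧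
        ‖Θ q.1 q.2 ω‖ ≤ β} :=
      ⟨k.2, h0steps, ((pi_norm_le_iff_of_nonneg hc0.le).2 hkc).trans hβ⟩
    obtain ⟨hκmem, hκmin⟩ := hκ ω
    have hdecomp := fun θ => ClippedDNN.integral_sq_loss_eq_add (P := P) hX1 (hYmeas 1 h1M)
      (hY 1 h1M) (hfm θ) hE'm (hfuv θ) hE'uv hcond'
    have h1 := hS ω _ fun i => (norm_le_pi_norm (Θ (κ ω).1 (κ ω).2 ω) i).trans hκmem.2.2
    have h2 := hS ω _ fun i => (hkc i).trans hβ
    rw [show m ω = ClippedDNN.paramDist D (Θ k 0 ω) θs from hk]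
    exact ClippedDNN.error_le_of_argMin (e := e) (R := fun θ => ClippedDNN.empiricalRisk M
        (fun j => X j ω) (fun j => Y j ω) (f θ)) (σ := ∫ ω, |E' (X 1 ω) - Y 1 ω| ^ 2 ∂P)
      (by rw [← hdecomp]; exact h1) (by rw [← hdecomp]; exact h2) (hκmin _ hmemk) (hest _ hkc)
  -- Minkowski's inequality for the sum of the three errors
  have hconst : ∀ (r : ℝ) (g : Ω → ℝ), 0 ≤ r → Measurable g → ∀ t : ℝ,
      (∫⁻ ω, ENNReal.ofReal (g ω) ^ max p 1 ∂P) ^ (1 / max p 1) ≤ ENNReal.ofReal t →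
      (∫⁻ ω, ENNReal.ofReal (r * g ω) ^ max p 1 ∂P) ^ (1 / max p 1) ≤ ENNReal.ofReal (r * t) := by
    intro r g hr hg t h
    simp_rw [ENNReal.ofReal_mul hr, ENNReal.mul_rpow_of_nonneg _ _ hp0'.le]
    rw [lintegral_const_mul _ (hg.ennreal_ofReal.pow_const _),
      ENNReal.mul_rpow_of_nonneg _ _ (by positivity), ← ENNReal.rpow_mul,
      mul_one_div_cancel hp0'.ne', ENNReal.rpow_one]
    exact mul_le_mul_right h _
  have hBp : (∫⁻ _ω, ENNReal.ofReal B ^ max p 1 ∂P) ^ (1 / max p 1) ≤ ENNReal.ofReal B := by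
    rw [lintegral_const, measure_univ, mul_one, ← ENNReal.rpow_mul, mul_one_div_cancel hp0'.ne',
      ENNReal.rpow_one]
  have hmink1 := ENNReal.lintegral_Lp_add_le (μ := P) (p := max p 1)
    (f := fun _ => ENNReal.ofReal B) (g := fun ω => ENNReal.ofReal (C * m ω))
    aemeasurable_const (hmm.const_mul C).ennreal_ofReal.aemeasurable hp1
  have hmink2 := ENNReal.lintegral_Lp_add_le (μ := P) (p := max p 1)
    (f := (fun _ => ENNReal.ofReal B) + fun ω => ENNReal.ofReal (C * m ω))
    (g := fun ω => ENNReal.ofReal (2 * S ω))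
    (measurable_const.add (hmm.const_mul C).ennreal_ofReal).aemeasurable
    (hSm.const_mul 2).ennreal_ofReal.aemeasurable hp1
  have hmono : (∫⁻ ω, (∫⁻ x in ClippedDNN.cube d a b,
      ENNReal.ofReal (|f (Θ (κ ω).1 (κ ω).2 ω) x - E x| ^ 2) ∂(P.map (X 1))) ^ max p 1 ∂P)
        ^ (1 / max p 1)
      ≤ (∫⁻ ω, (ENNReal.ofReal B + ENNReal.ofReal (C * m ω) + ENNReal.ofReal (2 * S ω))
          ^ max p 1 ∂P) ^ (1 / max p 1) := by
    refine ENNReal.rpow_le_rpow (lintegral_mono_ae ?_) (by positivity)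
    filter_upwards [hpt] with ω hω
    refine ENNReal.rpow_le_rpow ?_ hp0'.le
    rw [herr, ← ENNReal.ofReal_add hB0 (mul_nonneg hC0 (hm0 ω)), ← ENNReal.ofReal_add
      (add_nonneg hB0 (mul_nonneg hC0 (hm0 ω))) (mul_nonneg zero_le_two (hS0 ω))]
    exact ENNReal.ofReal_le_ofReal hω
  refine hmono.trans (hmink2.trans ((add_le_add (hmink1.trans (add_le_add hBp
    (hconst C m hC0 hmm _ hopt))) (hconst 2 S zero_le_two hSm _ hSp)).trans ?_))
  have hcard : (Fintype.card (Set.Icc 1 K) : ℝ) = K := by simp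
  rw [← ENNReal.ofReal_add hB0 (by positivity), ← ENNReal.ofReal_add (by positivity)
    (by positivity), hcard]
  refine ENNReal.ofReal_le_ofReal (add_le_add (add_le_add le_rfl ?_) (le_of_eq (by ring)))
  have hexp : (L : ℝ)⁻¹ * (((W : ℝ) + 1) ^ 2)⁻¹ ≤ 1 / (D : ℝ) := by
    rw [← mul_inv, one_div]
    refine inv_anti₀ (by exact_mod_cast hD1) ?_
    exact_mod_cast ClippedDNN.paramCount_le hW
  calc C * (2 * c * max p 1 / (K : ℝ) ^ (1 / (D : ℝ)))
      ≤ C * (2 * c * max p 1 / (K : ℝ) ^ ((L : ℝ)⁻¹ * (((W : ℝ) + 1) ^ 2)⁻¹)) := by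
        have := Real.rpow_le_rpow_of_exponent_le hK1 hexp
        gcongr
    _ = _ := by rw [hC, pow_succ c L]; ring
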